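/- Let $\mathcal G$ be a (locally compact) Hausdorff étale groupoid with compact unit space $X=\mathcal G^{(0)}$, source map $s$ and range map $r$. A $C(X)$-algebra is a C*-algebra $A$ (not necessarily unital) with a non-degenerate $*$-homomorphism from $C(X)$ into the centre of the multiplier algebra of $A$; its fibres are $A_x=A/I_x$, $I_x=\overline{\operatorname{span}}\{fa : f\in C(X),\ f(x)=0,\ a\in A\}$, with $a_x=a+I_x$, and $\mathcal A=\bigsqcup_{x}A_x$ carries its usual upper-semicontinuous bundle topology, with $p:\mathcal A\to X$. An action of $\mathcal G$ on $A$ is a family of $*$-isomorphisms $\alpha_\gamma:A_{s(\gamma)}\to A_{r(\gamma)}$ with $\alpha_{\eta\gamma}=\alpha_\eta\alpha_\gamma$ for composable $\eta,\gamma$, such that $(\gamma,a)\mapsto\alpha_\gamma(a)$ is continuous from $\mathcal G*_s\mathcal A=\{(\gamma,a)\in\mathcal G\times\mathcal A : s(\gamma)=p(a)\}$ to $\mathcal A$; then $(A,\alpha)$ is a $\mathcal G$-algebra. A $C(X)$-map is a bounded $C(X)$-linear map $\varphi:A\to B$; it induces $\varphi_x:A_x\to B_x$, and a $C(X)$-map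 between $\mathcal G$-algebras $(A,\alpha)$, $(B,\beta)$ is $\mathcal G$-equivariant if $\varphi_{r(\gamma)}\circ\alpha_\gamma=\beta_\gamma\circ\varphi_{s(\gamma)}$ for all $\gamma$. Let $\operatorname{Ind}A=\Gamma_b(\mathcal G,\mathcal G*_s\mathcal A)$ be the C*-algebra of bounded continuous sections, a $C(X)$-algebra by $gf=(g\circ r)f$, and write $[f]_x$ for the class of $f$ in $(\operatorname{Ind}A)_x$. **Proposition.** (1) For every $C(X)$-algebra $A$, $\operatorname{Ind}A$ is a $\mathcal G$-algebra: there is exactly one action of $\mathcal G$ on $\operatorname{Ind}A$ such that, for all $\gamma\in\mathcal G$, all open bisections $B\ni\gamma$, all $h\in C(X)$ that are $1$ near $r(\gamma)$ and vanish outside $r(B)$, and all $f\in\operatorname{Ind}A$, one has $h\cdot B.f\in\operatorname{Ind}A$ and $\gamma.[f]_{s(\gamma)}=[h\cdot B.f]_{r(\gamma)}$. Here $(h\cdot B.f)(\eta)=h(r(\eta))f(\xi^{-1}\eta)$ if $r(\eta)=r(\xi)$ with $\xi\in B$, and $(h\cdot B.f)(\eta)=0$ if $r(\eta)\notin r(B)$.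 If $A$ is unital, so is $\operatorname{Ind}A$. (2) For a $C(X)$-map $\varphi:A\to B$, put $(\operatorname{Ind}\varphi)(f)(\gamma)=\varphi_{s(\gamma)}(f(\gamma))$. Then $\operatorname{Ind}\varphi:\operatorname{Ind}A\to\operatorname{Ind}B$ is $\mathcal G$-equivariant, it is ucp (unital completely positive, between unital algebras) if $\varphi$ is, and a $*$-homomorphism if $\varphi$ is; moreover $\operatorname{Ind}$ preserves identities and composition. (3) For a $\mathcal G$-algebra $(W,\alpha)$, a $C(X)$-algebra $A$ and a $C(X)$-map $\varphi:W\to A$, put $(\operatorname{rInd}\varphi)(a)(\gamma)=\varphi_{s(\gamma)}(\alpha_\gamma^{-1}(a_{r(\gamma)}))$. If $W$ and $A$ are unital, $\operatorname{rInd}$ is a bijection from the ucp $C(X)$-maps $W\to A$ onto the $\mathcal G$-equivariant ucp $C(X)$-maps $W\to\operatorname{Ind}A$. For arbitrary $W$ and $A$ it is a bijection from the $C(X)$-linear $*$-homomorphisms $W\to A$ onto the $\mathcal G$-equivariant $C(X)$-linear $*$-homomorphisms $W\to\operatorname{Ind}A$. Its inverse restricts sections to $X$: $\varphi(a)_x=(\operatorname{rInd}\varphi)(a)(x)$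 for $a\in W$, $x\in X$. (4) These bijections are natural: $\operatorname{rInd}(\varphi\circ j)=(\operatorname{rInd}\varphi)\circ j$ for every $\mathcal G$-equivariant $C(X)$-map $j$ of $\mathcal G$-algebras, and $\operatorname{rInd}(\chi\circ\varphi)=\operatorname{Ind}\chi\circ\operatorname{rInd}\varphi$ for every $C(X)$-map $\chi$. Hence $\operatorname{Ind}$ is right adjoint to the restriction functor that forgets the $\mathcal G$-action, for ucp maps between unital algebras and for $*$-homomorphisms. -/

import Mathlib

open Topology
open scoped MultiplierAlgebra ENNReal

namespace GpdAlg

/-- A `C(X)`-algebra (`X` compact Hausdorff, so that `C_0(X) = C(X)`): a C*-algebra `A` (possibly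
without unit) with a `*`-homomorphism `Φ` from `C(X)` into the centre of the multiplier algebra
of `A` which is non-degenerate. The product `f a` is `L_{Φ(f)}(a)`, where a multiplier is a double
centralizer `(L, R)`. -/
class CXAlgebra (X A : Type*) [TopologicalSpace X] [CompactSpace X]
    [NonUnitalCStarAlgebra A] where
  toMultiplier : C(X, ℂ) →⋆ₙₐ[ℂ] 𝓜(ℂ, A)
  central : ∀ (f : C(X, ℂ)) (m : 𝓜(ℂ, A)), Commute (toMultiplier f) m
  nondegenerate : Dense (Submodule.span ℂ
    {b : A | ∃ (f : C(X, ℂ)) (a : A), (toMultiplier f).fst a = b} : Set A)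

section Action

variable {X A : Type*} [TopologicalSpace X] [CompactSpace X] [NonUnitalCStarAlgebra A]
  [CXAlgebra X A]

/-- The product `f a` for `f ∈ C(X)` and `a ∈ A`. -/
noncomputable def act (f : C(X, ℂ)) (a : A) : A :=
  (CXAlgebra.toMultiplier (A := A) f).fst a

theorem act_add (f : C(X, ℂ)) (a b : A) : act f (a + b) = act f a + act f b := map_add _ _ _

theorem act_sub (f : C(X, ℂ)) (a b : A) : act f (a - b) = act f a - act f b := map_sub _ _ _

theorem act_smul (f : C(X, ℂ)) (c : ℂ) (a : A) : act f (c • a) = c • act f a := map_smul _ _ _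

theorem act_zero (f : C(X, ℂ)) : act f (0 : A) = 0 := map_zero _

theorem add_act (f g : C(X, ℂ)) (a : A) : act (f + g) a = act f a + act g a := by
  simp [act]

theorem sub_act (f g : C(X, ℂ)) (a : A) : act (f - g) a = act f a - act g a := by
  simp [act]

theorem smul_act (c : ℂ) (f : C(X, ℂ)) (a : A) : act (c • f) a = c • act f a := by
  simp [act]

theorem mul_act (f g : C(X, ℂ)) (a : A) : act (f * g) a = act f (act g a) := by
  simp [act]

theorem norm_act_le (f : C(X, ℂ)) (a : A) : ‖act f a‖ ≤ ‖f‖ * ‖a‖ := by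
  refine ((CXAlgebra.toMultiplier (A := A) f).fst.le_opNorm a).trans ?_
  rw [DoubleCentralizer.norm_fst]
  gcongr
  exact NonUnitalStarAlgHom.norm_apply_le _ f

theorem continuous_act (f : C(X, ℂ)) : Continuous (act f : A → A) :=
  (CXAlgebra.toMultiplier (A := A) f).fst.continuous

theorem mul_act_right (f : C(X, ℂ)) (a b : A) : a * act f b = act f (a * b) := by
  have h := congrArg (fun m : 𝓜(ℂ, A) => m.fst b)
    (CXAlgebra.central f (DoubleCentralizer.coe ℂ a)).eq
  simpa [act] using h.symm

theorem eq_of_mul_left {a b : A} (h : ∀ c : A, c * a = c * b) : a = b := by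
  have h1 := h (star (a - b))
  rw [← sub_eq_zero, ← mul_sub, CStarRing.star_mul_self_eq_zero_iff, sub_eq_zero] at h1
  exact h1

theorem eq_of_mul_right {a b : A} (h : ∀ c : A, a * c = b * c) : a = b := by
  have h1 := h (star (a - b))
  rw [← sub_eq_zero, ← sub_mul, CStarRing.mul_star_self_eq_zero_iff, sub_eq_zero] at h1
  exact h1

theorem act_mul_left (f : C(X, ℂ)) (a b : A) : act f a * b = act f (a * b) := by
  refine eq_of_mul_left fun c => ?_
  have h : ∀ x y : A, x * act f y = (CXAlgebra.toMultiplier (A := A) f).snd x * y :=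
    fun x y => ((CXAlgebra.toMultiplier (A := A) f).central x y).symm
  rw [← mul_assoc, h, h, mul_assoc]

theorem snd_eq_act (f : C(X, ℂ)) (a : A) :
    (CXAlgebra.toMultiplier (A := A) f).snd a = act f a := by
  refine eq_of_mul_right fun c => ?_
  rw [DoubleCentralizer.central, act_mul_left, ← mul_act_right]
  rfl

theorem star_act (f : C(X, ℂ)) (a : A) : star (act f a) = act (star f) (star a) := by
  have h : (CXAlgebra.toMultiplier (A := A) (star f)).fst (star a) =
      star ((CXAlgebra.toMultiplier (A := A) f).snd a) := by
    rw [map_star (CXAlgebra.toMultiplier (A := A)) f, DoubleCentralizer.star_fst, star_star]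
  rw [snd_eq_act] at h
  exact h.symm

theorem one_act (a : A) : act (1 : C(X, ℂ)) a = a := by
  have key : ∀ b ∈ (Submodule.span ℂ
      {b : A | ∃ (f : C(X, ℂ)) (a : A), (CXAlgebra.toMultiplier f).fst a = b} : Set A),
      act (1 : C(X, ℂ)) b = b := by
    intro b hb
    induction hb using Submodule.span_induction with
    | mem x hx =>
      obtain ⟨f, c, rfl⟩ := hx
      change act 1 (act f c) = act f c
      rw [← mul_act, one_mul]
    | zero => exact act_zero _
    | add x y _ _ hx hy => rw [act_add, hx, hy]
    | smul c x _ hx => rw [act_smul, hx]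
  have hc : IsClosed {b : A | act (1 : C(X, ℂ)) b = b} :=
    isClosed_eq (continuous_act _) continuous_id
  exact (hc.closure_subset_iff.mpr key)
    ((CXAlgebra.nondegenerate (X := X) (A := A)).closure_eq ▸ Set.mem_univ a)

end Action

section Fibre

variable (X : Type*) {A : Type*} [TopologicalSpace X] [CompactSpace X]
  [NonUnitalCStarAlgebra A] [CXAlgebra X A]

variable {X} in
/-- The closed ideal `I_x = C_0(X ∖ x) A` of `A`. -/
noncomputable def fibreIdeal (A : Type*) [NonUnitalCStarAlgebra A] [CXAlgebra X A] (x : X) :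
    Submodule ℂ A :=
  (Submodule.span ℂ {b : A | ∃ (f : C(X, ℂ)) (a : A), f x = 0 ∧ act f a = b}).topologicalClosure

instance fibreIdeal_isClosed (x : X) : IsClosed (fibreIdeal A x : Set A) :=
  Submodule.isClosed_topologicalClosure _

/-- The fibre `A_x = A / I_x`. -/
def Fibre (A : Type*) [NonUnitalCStarAlgebra A] [CXAlgebra X A] (x : X) : Type _ :=
  A ⧸ fibreIdeal A x

variable {X}

noncomputable instance (x : X) : NormedAddCommGroup (Fibre X A x) :=
  inferInstanceAs (NormedAddCommGroup (A ⧸ fibreIdeal A x))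

noncomputable instance (x : X) : NormedSpace ℂ (Fibre X A x) :=
  inferInstanceAs (NormedSpace ℂ (A ⧸ fibreIdeal A x))

noncomputable instance (x : X) : CompleteSpace (Fibre X A x) :=
  inferInstanceAs (CompleteSpace (A ⧸ fibreIdeal A x))

/-- The quotient map `A → A_x`, `a ↦ a + I_x`. -/
noncomputable def proj (x : X) : A →ₗ[ℂ] Fibre X A x := (fibreIdeal A x).mkQ

theorem proj_surjective (x : X) : Function.Surjective (proj x : A → Fibre X A x) :=
  Submodule.mkQ_surjective _

theorem proj_eq_zero {x : X} {a : A} : proj x a = 0 ↔ a ∈ fibreIdeal A x :=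
  Submodule.Quotient.mk_eq_zero _

theorem proj_eq_iff {x : X} {a b : A} : proj x a = proj x b ↔ a - b ∈ fibreIdeal A x := by
  rw [← sub_eq_zero, ← map_sub, proj_eq_zero]

theorem norm_proj_le (x : X) (a : A) : ‖proj x a‖ ≤ ‖a‖ :=
  Submodule.Quotient.norm_mk_le (fibreIdeal A x) a

theorem act_mem_fibreIdeal {x : X} {f : C(X, ℂ)} (hf : f x = 0) (a : A) :
    act f a ∈ fibreIdeal A x :=
  Submodule.le_topologicalClosure _ (Submodule.subset_span ⟨f, a, hf, rfl⟩)

/-- A closed subspace containing the generators of `I_x` contains `I_x`. -/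
theorem fibreIdeal_induction {x : X} {p : A → Prop} (hgen : ∀ (f : C(X, ℂ)) (a : A), f x = 0 →
    p (act f a)) (h0 : p 0) (hadd : ∀ a b, p a → p b → p (a + b))
    (hsmul : ∀ (c : ℂ) a, p a → p (c • a)) (hcl : IsClosed {a | p a}) {a : A}
    (ha : a ∈ fibreIdeal A x) : p a := by
  have h1 : ∀ b ∈ Submodule.span ℂ
      {b : A | ∃ (f : C(X, ℂ)) (a : A), f x = 0 ∧ act f a = b}, p b := by
    intro b hb
    induction hb using Submodule.span_induction with
    | mem b hb => obtain ⟨f, a, hf, rfl⟩ := hb; exact hgen f a hf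
    | zero => exact h0
    | add a b _ _ ha hb => exact hadd a b ha hb
    | smul c a _ ha => exact hsmul c a ha
  exact hcl.closure_subset_iff.mpr h1 ha

theorem mul_mem_fibreIdeal_left {x : X} (b : A) {a : A} (ha : a ∈ fibreIdeal A x) :
    b * a ∈ fibreIdeal A x := by
  refine fibreIdeal_induction (p := fun a => b * a ∈ fibreIdeal A x) ?_ ?_ ?_ ?_ ?_ ha
  · intro f a hf
    rw [mul_act_right]
    exact act_mem_fibreIdeal hf _
  · simp
  · intro a b ha hb
    rw [mul_add]
    exact add_mem ha hb
  · intro c a ha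
    rw [mul_smul_comm]
    exact Submodule.smul_mem _ _ ha
  · exact (fibreIdeal_isClosed X x).preimage (continuous_const_mul b)

theorem star_mem_fibreIdeal {x : X} {a : A} (ha : a ∈ fibreIdeal A x) :
    star a ∈ fibreIdeal A x := by
  refine fibreIdeal_induction (p := fun a => star a ∈ fibreIdeal A x) ?_ ?_ ?_ ?_ ?_ ha
  · intro f a hf
    rw [star_act]
    exact act_mem_fibreIdeal (by simp [hf]) _
  · simp
  · intro a b ha hb
    rw [star_add]
    exact add_mem ha hb
  · intro c a ha
    rw [star_smul]
    exact Submodule.smul_mem _ _ ha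
  · exact (fibreIdeal_isClosed X x).preimage continuous_star

theorem mul_mem_fibreIdeal_right {x : X} (b : A) {a : A} (ha : a ∈ fibreIdeal A x) :
    a * b ∈ fibreIdeal A x := by
  have h := star_mem_fibreIdeal (mul_mem_fibreIdeal_left (star b) (star_mem_fibreIdeal ha))
  simpa using h

noncomputable instance (x : X) : Mul (Fibre X A x) where
  mul := Quotient.map₂ (· * ·) (by
    intro a a' ha b b' hb
    have ha := (Submodule.quotientRel_def _).mp ha
    have hb := (Submodule.quotientRel_def _).mp hb
    refine (Submodule.quotientRel_def _).mpr ?_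
    have : a * b - a' * b' = (a - a') * b + a' * (b - b') := by
      rw [sub_mul, mul_sub]; abel
    rw [this]
    exact add_mem (mul_mem_fibreIdeal_right b ha) (mul_mem_fibreIdeal_left a' hb))

noncomputable instance (x : X) : Star (Fibre X A x) where
  star := Quotient.map star (by
    intro a a' ha
    have ha := (Submodule.quotientRel_def _).mp ha
    refine (Submodule.quotientRel_def _).mpr ?_
    rw [← star_sub]
    exact star_mem_fibreIdeal ha)

theorem proj_mul (x : X) (a b : A) : proj x (a * b) = proj x a * proj x b := rfl

theorem proj_star (x : X) (a : A) : proj x (star a) = star (proj x a) := rfl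

/-- Functions of norm at most one with value one at `x` push `I_x` to zero. -/
theorem exists_small_act {x : X} {a : A} (ha : a ∈ fibreIdeal A x) {ε : ℝ} (hε : 0 < ε) :
    ∃ f : C(X, ℂ), f x = 1 ∧ ‖f‖ ≤ 1 ∧ ‖act f a‖ < ε := by
  revert ε
  refine fibreIdeal_induction (p := fun a => ∀ {ε : ℝ}, 0 < ε →
    ∃ f : C(X, ℂ), f x = 1 ∧ ‖f‖ ≤ 1 ∧ ‖act f a‖ < ε) ?_ ?_ ?_ ?_ ?_ ha
  · intro h a hx ε hε
    obtain ⟨t, ht0, ht⟩ : ∃ t : ℝ, 0 < t ∧ t * ‖a‖ < ε :=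
      ⟨ε / (‖a‖ + 1), by positivity, by
        rw [div_mul_eq_mul_div, div_lt_iff₀ (by positivity)]
        nlinarith [norm_nonneg a]⟩
    have hden : ∀ y, (1 + ((‖h y‖ / t : ℝ) : ℂ)) ≠ 0 := by
      intro y
      have : (0 : ℝ) < 1 + ‖h y‖ / t := by positivity
      exact_mod_cast this.ne'
    have hnd : ∀ y, ‖(1 + ((‖h y‖ / t : ℝ) : ℂ))‖ = 1 + ‖h y‖ / t := by
      intro y
      have : (0 : ℝ) ≤ 1 + ‖h y‖ / t := by positivity
      rw [← Complex.ofReal_one, ← Complex.ofReal_add, Complex.norm_of_nonneg this]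
    let f : C(X, ℂ) := ⟨fun y => (1 + ((‖h y‖ / t : ℝ) : ℂ))⁻¹,
      Continuous.inv₀ (by fun_prop) hden⟩
    refine ⟨f, by simp [f, hx], ?_, ?_⟩
    · rw [ContinuousMap.norm_le _ zero_le_one]
      intro y
      simp only [f, ContinuousMap.coe_mk, norm_inv, hnd]
      apply inv_le_one_of_one_le₀
      have : 0 ≤ ‖h y‖ / t := by positivity
      linarith
    · rw [← mul_act]
      refine (norm_act_le _ _).trans_lt (lt_of_le_of_lt ?_ ht)
      gcongr
      rw [ContinuousMap.norm_le _ ht0.le]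
      intro y
      simp only [f, ContinuousMap.mul_apply, ContinuousMap.coe_mk, norm_mul, norm_inv, hnd]
      rw [inv_mul_le_iff₀ (by positivity), add_mul, div_mul_cancel₀ _ ht0.ne']
      linarith
  · intro ε hε
    exact ⟨1, by simp, by
      rw [ContinuousMap.norm_le _ zero_le_one]; simp, by simpa [act_zero] using hε⟩
  · intro a b ha hb ε hε
    obtain ⟨f, hf1, hf2, hf3⟩ := ha (half_pos hε)
    obtain ⟨g, hg1, hg2, hg3⟩ := hb (half_pos hε)
    refine ⟨f * g, by simp [hf1, hg1], (norm_mul_le _ _).trans ?_, ?_⟩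
    · exact mul_le_one₀ hf2 (norm_nonneg _) hg2
    · rw [act_add]
      refine (norm_add_le _ _).trans_lt ?_
      have h1 : ‖act (f * g) a‖ ≤ ‖act f a‖ := by
        rw [mul_comm, mul_act]
        exact (norm_act_le _ _).trans (mul_le_of_le_one_left (norm_nonneg _) hg2)
      have h2 : ‖act (f * g) b‖ ≤ ‖act g b‖ := by
        rw [mul_act]
        exact (norm_act_le _ _).trans (mul_le_of_le_one_left (norm_nonneg _) hf2)
      linarith
  · intro c a ha ε hε
    obtain ⟨f, hf1, hf2, hf3⟩ := ha (ε := ε / (‖c‖ + 1)) (by positivity)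
    refine ⟨f, hf1, hf2, ?_⟩
    rw [act_smul, norm_smul]
    rw [lt_div_iff₀ (by positivity)] at hf3
    nlinarith [norm_nonneg (act f a)]
  · rw [← isSeqClosed_iff_isClosed]
    intro u a hu hlim ε hε
    obtain ⟨n, hn⟩ := (Metric.tendsto_atTop.mp hlim (ε / 2) (half_pos hε))
    obtain ⟨f, hf1, hf2, hf3⟩ := hu n (half_pos hε)
    refine ⟨f, hf1, hf2, ?_⟩
    have h1 : act f a = act f (u n) - act f (u n - a) := by rw [act_sub]; abel
    have h2 : ‖act f (u n - a)‖ ≤ ‖u n - a‖ :=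
      (norm_act_le _ _).trans (mul_le_of_le_one_left (norm_nonneg _) hf2)
    have h3 := hn n le_rfl
    rw [dist_eq_norm] at h3
    rw [h1]
    refine (norm_sub_le _ _).trans_lt ?_
    linarith

theorem proj_act (f : C(X, ℂ)) (x : X) (a : A) : proj x (act f a) = f x • proj x a := by
  rw [← map_smul, proj_eq_iff]
  have : act f a - f x • a = act (f - f x • (1 : C(X, ℂ))) a := by
    rw [sub_act, smul_act, one_act]
  rw [this]
  exact act_mem_fibreIdeal (by simp) a

theorem norm_proj_le_norm_act {x : X} {f : C(X, ℂ)} (hf : f x = 1) (a : A) :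
    ‖proj x a‖ ≤ ‖act f a‖ := by
  have h : proj x a = proj x (act f a) := by rw [proj_act, hf, one_smul]
  rw [h]
  exact norm_proj_le _ _

theorem exists_norm_act_lt {x : X} {a : A} {r : ℝ} (h : ‖proj x a‖ < r) :
    ∃ f : C(X, ℂ), f x = 1 ∧ ‖f‖ ≤ 1 ∧ ‖act f a‖ < r := by
  obtain ⟨b, hb, hb'⟩ := Submodule.Quotient.norm_mk_lt (S := fibreIdeal A x) (proj x a)
    (sub_pos.mpr h)
  have hab : a - b ∈ fibreIdeal A x := proj_eq_iff.mp hb.symm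
  have hb2 : ‖b‖ < r := by
    have h2 : ‖b‖ < ‖proj x a‖ + (r - ‖proj x a‖) := hb'
    linarith
  obtain ⟨f, hf1, hf2, hf3⟩ := exists_small_act hab (sub_pos.mpr hb2)
  refine ⟨f, hf1, hf2, ?_⟩
  have h1 : act f a = act f (a - b) + act f b := by rw [act_sub]; abel
  have h2 : ‖act f b‖ ≤ ‖b‖ :=
    (norm_act_le _ _).trans (mul_le_of_le_one_left (norm_nonneg _) hf2)
  rw [h1]
  refine (norm_add_le _ _).trans_lt ?_
  linarith

noncomputable instance (x : X) : NonUnitalNormedRing (Fibre X A x) where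
  left_distrib a b c := by
    obtain ⟨a, rfl⟩ := proj_surjective x a
    obtain ⟨b, rfl⟩ := proj_surjective x b
    obtain ⟨c, rfl⟩ := proj_surjective x c
    simp only [← map_add, ← proj_mul, mul_add]
  right_distrib a b c := by
    obtain ⟨a, rfl⟩ := proj_surjective x a
    obtain ⟨b, rfl⟩ := proj_surjective x b
    obtain ⟨c, rfl⟩ := proj_surjective x c
    simp only [← map_add, ← proj_mul, add_mul]
  zero_mul a := by
    obtain ⟨a, rfl⟩ := proj_surjective x a
    rw [← map_zero (proj x), ← proj_mul, zero_mul]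
  mul_zero a := by
    obtain ⟨a, rfl⟩ := proj_surjective x a
    rw [← map_zero (proj x), ← proj_mul, mul_zero]
  mul_assoc a b c := by
    obtain ⟨a, rfl⟩ := proj_surjective x a
    obtain ⟨b, rfl⟩ := proj_surjective x b
    obtain ⟨c, rfl⟩ := proj_surjective x c
    simp only [← proj_mul, mul_assoc]
  dist_eq := NormedAddCommGroup.dist_eq
  norm_mul_le a b := by
    obtain ⟨a, rfl⟩ := proj_surjective x a
    obtain ⟨b, rfl⟩ := proj_surjective x b
    refine le_of_forall_pos_lt_add fun ε hε => ?_
    obtain ⟨δ, hδ0, hδ⟩ : ∃ δ : ℝ, 0 < δ ∧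
        (‖proj x a‖ + δ) * (‖proj x b‖ + δ) < ‖proj x a‖ * ‖proj x b‖ + ε := by
      have hcont : Filter.Tendsto (fun δ : ℝ => (‖proj x a‖ + δ) * (‖proj x b‖ + δ)) (𝓝[>] 0)
          (𝓝 ((‖proj x a‖ + 0) * (‖proj x b‖ + 0))) := by
        apply Filter.Tendsto.mono_left _ nhdsWithin_le_nhds
        exact Continuous.tendsto (by fun_prop) 0
      have := hcont.eventually_lt_const (u := ‖proj x a‖ * ‖proj x b‖ + ε) (by simpa using hε)
      obtain ⟨δ, h1, h2⟩ := (this.and self_mem_nhdsWithin).exists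
      exact ⟨δ, h2, h1⟩
    obtain ⟨f, hf1, -, hf3⟩ := exists_norm_act_lt (lt_add_of_pos_right ‖proj x a‖ hδ0)
    obtain ⟨g, hg1, -, hg3⟩ := exists_norm_act_lt (lt_add_of_pos_right ‖proj x b‖ hδ0)
    have h : proj x a * proj x b = proj x (act f a * act g b) := by
      rw [proj_mul, proj_act, proj_act, hf1, hg1, one_smul, one_smul]
    rw [h]
    refine lt_of_le_of_lt ((norm_proj_le _ _).trans (norm_mul_le _ _)) (lt_of_le_of_lt ?_ hδ)
    gcongr

noncomputable instance (x : X) : StarRing (Fibre X A x) where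
  star_involutive a := by
    obtain ⟨a, rfl⟩ := proj_surjective x a
    simp only [← proj_star, star_star]
  star_mul a b := by
    obtain ⟨a, rfl⟩ := proj_surjective x a
    obtain ⟨b, rfl⟩ := proj_surjective x b
    simp only [← proj_star, ← proj_mul, star_mul]
  star_add a b := by
    obtain ⟨a, rfl⟩ := proj_surjective x a
    obtain ⟨b, rfl⟩ := proj_surjective x b
    simp only [← proj_star, ← map_add, star_add]

instance (x : X) : CStarRing (Fibre X A x) where
  norm_mul_self_le a := by
    obtain ⟨a, rfl⟩ := proj_surjective x a
    refine le_of_forall_pos_le_add fun ε hε => ?_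
    rw [← proj_star, ← proj_mul]
    obtain ⟨f, hf1, hf2, hf3⟩ :=
      exists_norm_act_lt (lt_add_of_pos_right ‖proj x (star a * a)‖ hε)
    refine le_trans ?_ hf3.le
    have h1 : ‖act f a‖ * ‖act f a‖ ≤ ‖act f (star a * a)‖ := by
      rw [← CStarRing.norm_star_mul_self, star_act, act_mul_left, mul_act_right]
      refine (norm_act_le _ _).trans (mul_le_of_le_one_left (norm_nonneg _) ?_)
      rwa [norm_star]
    have h2 := norm_proj_le_norm_act hf1 a
    nlinarith [norm_nonneg (proj x a)]

/-- The fibres of a `C(X)`-algebra are C*-algebras. -/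
noncomputable instance (x : X) : NonUnitalCStarAlgebra (Fibre X A x) where
  smul_assoc c a b := by
    obtain ⟨a, rfl⟩ := proj_surjective x a
    obtain ⟨b, rfl⟩ := proj_surjective x b
    simp only [smul_eq_mul, ← map_smul, ← proj_mul, smul_mul_assoc]
  smul_comm c a b := by
    obtain ⟨a, rfl⟩ := proj_surjective x a
    obtain ⟨b, rfl⟩ := proj_surjective x b
    simp only [smul_eq_mul, ← map_smul, ← proj_mul, mul_smul_comm]
  star_smul c a := by
    obtain ⟨a, rfl⟩ := proj_surjective x a
    simp only [← map_smul, ← proj_star, star_smul]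

end Fibre

section Bundle

/-- The bundle `𝒜 = ⨆ A_x` over `X` associated with a `C(X)`-algebra `A`. -/
structure CXBundle (X A : Type*) [TopologicalSpace X] [CompactSpace X]
    [NonUnitalCStarAlgebra A] [CXAlgebra X A] where
  /-- the bundle map `p : 𝒜 → X` -/
  base : X
  val : Fibre X A base

variable {X A : Type*} [TopologicalSpace X] [CompactSpace X]
  [NonUnitalCStarAlgebra A] [CXAlgebra X A]

/-- The topology of the bundle `𝒜`: it is generated by the tubes
`W(a, U, ε) = {b ∈ 𝒜 | p(b) ∈ U and ‖b - a_{p(b)}‖ < ε}` with `a ∈ A`, `U ⊆ X` open and `ε > 0`.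
This is the unique topology that makes `𝒜` an upper-semicontinuous C*-bundle for which the elements
of `A` are the continuous sections. -/
instance : TopologicalSpace (CXBundle X A) :=
  TopologicalSpace.generateFrom {W | ∃ (a : A) (U : Set X) (ε : ℝ), IsOpen U ∧ 0 < ε ∧
    W = {b : CXBundle X A | b.base ∈ U ∧ ‖b.val - proj b.base a‖ < ε}}

/-- The pullback bundle `Y *_τ 𝒜 = {(y, a) ∈ Y × 𝒜 | τ(y) = p(a)}` along `τ : Y → X`, with the
relative topology of `Y × 𝒜`. -/
def PullbackBundle {Y : Type*} (τ : Y → X) (A : Type*)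
    [NonUnitalCStarAlgebra A] [CXAlgebra X A] : Type _ :=
  {q : Y × CXBundle X A // τ q.1 = q.2.base}

instance {Y : Type*} [TopologicalSpace Y] (τ : Y → X) :
    TopologicalSpace (PullbackBundle τ A) :=
  inferInstanceAs (TopologicalSpace {q : Y × CXBundle X A // τ q.1 = q.2.base})

/-- The section `Y → Y *_τ 𝒜`, `y ↦ (y, f(y))`, given by a family `f(y) ∈ A_{τ(y)}`. -/
def toPullback {Y : Type*} (τ : Y → X) (f : ∀ y, Fibre X A (τ y)) (y : Y) : PullbackBundle τ A :=
  ⟨(y, ⟨τ y, f y⟩), rfl⟩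

/-- The identification `A_x = A_y` for `x = y`. -/
def Fibre.cast {x y : X} (h : x = y) (a : Fibre X A x) : Fibre X A y := h ▸ a

@[simp] theorem Fibre.cast_rfl {x : X} (a : Fibre X A x) : a.cast rfl = a := rfl

theorem CXBundle.mk_cast {x y : X} (h : x = y) (a : Fibre X A x) :
    (⟨y, a.cast h⟩ : CXBundle X A) = ⟨x, a⟩ := by
  subst h; rfl

theorem Fibre.cast_proj {x y : X} (h : x = y) (a : A) : (proj x a).cast h = proj y a := by
  subst h; rfl

theorem Fibre.norm_cast {x y : X} (h : x = y) (a : Fibre X A x) : ‖a.cast h‖ = ‖a‖ := by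
  subst h; rfl

/-- The fibrewise norms of an element are upper semicontinuous. -/
theorem eventually_norm_proj_lt {x : X} {a : A} {r : ℝ} (h : ‖proj x a‖ < r) :
    ∀ᶠ y in 𝓝 x, ‖proj y a‖ < r := by
  obtain ⟨f, hf1, -, hf3⟩ := exists_norm_act_lt h
  have hc : Filter.Tendsto (fun y => ‖f y‖ * r) (𝓝 x) (𝓝 (‖f x‖ * r)) :=
    Continuous.tendsto (by fun_prop) x
  rw [hf1, norm_one, one_mul] at hc
  filter_upwards [hc.eventually_const_lt hf3] with y hy
  have h1 : ‖f y‖ * ‖proj y a‖ ≤ ‖act f a‖ := by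
    rw [← norm_smul, ← proj_act]
    exact norm_proj_le _ _
  exact lt_of_mul_lt_mul_left (h1.trans_lt hy) (norm_nonneg _)

/-- A family is a continuous section iff locally it is uniformly approximated by elements of `A`. -/
theorem continuous_section_iff {Y : Type*} [TopologicalSpace Y] {τ : Y → X} (hτ : Continuous τ)
    (f : ∀ y, Fibre X A (τ y)) :
    Continuous (fun y => (⟨τ y, f y⟩ : CXBundle X A)) ↔
      ∀ y, ∀ ε : ℝ, 0 < ε → ∃ a : A, ∀ᶠ z in 𝓝 y, ‖f z - proj (τ z) a‖ < ε := by
  constructor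
  · intro h y ε hε
    obtain ⟨a, ha⟩ := proj_surjective (τ y) (f y)
    refine ⟨a, ?_⟩
    have ho : IsOpen {b : CXBundle X A | b.base ∈ Set.univ ∧ ‖b.val - proj b.base a‖ < ε} :=
      TopologicalSpace.isOpen_generateFrom_of_mem ⟨a, Set.univ, ε, isOpen_univ, hε, rfl⟩
    have hm := (ho.preimage h).mem_nhds (x := y) (by simpa [ha] using hε)
    filter_upwards [hm] with z hz using hz.2
  · intro h
    refine continuous_generateFrom_iff.mpr ?_
    rintro _ ⟨b, U, δ, hU, hδ, rfl⟩
    rw [isOpen_iff_mem_nhds]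
    rintro y ⟨hyU, hy⟩
    change ‖f y - proj (τ y) b‖ < δ at hy
    obtain ⟨ε, hε0, hε⟩ : ∃ ε : ℝ, 0 < ε ∧ ‖f y - proj (τ y) b‖ + 2 * ε < δ :=
      ⟨(δ - ‖f y - proj (τ y) b‖) / 3, by linarith, by linarith⟩
    obtain ⟨a, ha⟩ := h y ε hε0
    have h1 : ‖proj (τ y) (a - b)‖ < ‖f y - proj (τ y) b‖ + ε := by
      have : proj (τ y) (a - b) = (f y - proj (τ y) b) - (f y - proj (τ y) a) := by
        rw [map_sub]; abel
      rw [this]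
      refine (norm_sub_le _ _).trans_lt ?_
      linarith [ha.self_of_nhds]
    have h2 := hτ.continuousAt.eventually (eventually_norm_proj_lt h1)
    filter_upwards [ha, h2, hτ.continuousAt.eventually (hU.mem_nhds hyU)] with z hz1 hz2 hz3
    refine ⟨hz3, ?_⟩
    change ‖f z - proj (τ z) b‖ < δ
    have : f z - proj (τ z) b = (f z - proj (τ z) a) + proj (τ z) (a - b) := by
      rw [map_sub]; abel
    rw [this]
    refine (norm_add_le _ _).trans_lt ?_
    linarith

theorem continuous_toPullback_iff {Y : Type*} [TopologicalSpace Y] {τ : Y → X} (hτ : Continuous τ)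
    (f : ∀ y, Fibre X A (τ y)) :
    Continuous (toPullback τ f) ↔
      ∀ y, ∀ ε : ℝ, 0 < ε → ∃ a : A, ∀ᶠ z in 𝓝 y, ‖f z - proj (τ z) a‖ < ε := by
  rw [← continuous_section_iff hτ]
  constructor
  · intro h
    exact continuous_snd.comp (continuous_subtype_val.comp h)
  · intro h
    exact Continuous.subtype_mk (continuous_id.prodMk h) _

end Bundle

/-- A topological groupoid with unit space `X` and arrow space `G` whose range map is a local
homeomorphism (an étale groupoid). The product `mul γ η` is the composite `γη`, which exists when
the source of `γ` is the range of `η`. The unit space is recorded as a space `X` of its own with the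
unit inclusion `unit : X → G`, which is an embedding since it has the continuous left inverse
`src`. -/
structure EtaleGroupoid (X G : Type*) [TopologicalSpace X] [TopologicalSpace G] where
  src : G → X
  rng : G → X
  unit : X → G
  inv : G → G
  mul : ∀ γ η : G, src γ = rng η → G
  src_unit : ∀ x, src (unit x) = x
  rng_unit : ∀ x, rng (unit x) = x
  src_inv : ∀ γ, src (inv γ) = rng γ
  rng_inv : ∀ γ, rng (inv γ) = src γ
  src_mul : ∀ γ η h, src (mul γ η h) = src η
  rng_mul : ∀ γ η h, rng (mul γ η h) = rng γ
  unit_mul : ∀ γ, mul (unit (rng γ)) γ (src_unit _) = γ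
  mul_unit : ∀ γ, mul γ (unit (src γ)) (rng_unit _).symm = γ
  inv_mul : ∀ γ, mul (inv γ) γ (src_inv γ) = unit (src γ)
  mul_inv : ∀ γ, mul γ (inv γ) (rng_inv γ).symm = unit (rng γ)
  mul_assoc : ∀ (γ η ζ : G) (h₁ : src γ = rng η) (h₂ : src η = rng ζ),
    mul (mul γ η h₁) ζ ((src_mul γ η h₁).trans h₂) =
      mul γ (mul η ζ h₂) (h₁.trans (rng_mul η ζ h₂).symm)
  continuous_src : Continuous src
  continuous_unit : Continuous unit
  continuous_inv : Continuous inv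
  continuous_mul : Continuous fun p : {p : G × G // src p.1 = rng p.2} => mul p.1.1 p.1.2 p.2
  isLocalHomeomorph_rng : IsLocalHomeomorph rng

theorem EtaleGroupoid.continuous_rng {X G : Type*} [TopologicalSpace X] [TopologicalSpace G]
    (𝓖 : EtaleGroupoid X G) : Continuous 𝓖.rng := 𝓖.isLocalHomeomorph_rng.continuous

theorem EtaleGroupoid.mul_congr_right {X G : Type*} [TopologicalSpace X] [TopologicalSpace G]
    (𝓖 : EtaleGroupoid X G) {γ η η' : G} (e : η = η') (h : 𝓖.src γ = 𝓖.rng η) :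
    𝓖.mul γ η h = 𝓖.mul γ η' (e ▸ h) := by
  subst e; rfl

/-- An open bisection: an open set of arrows on which source and range are injective. -/
def IsOpenBisection {X G : Type*} [TopologicalSpace X] [TopologicalSpace G]
    (𝓖 : EtaleGroupoid X G) (B : Set G) : Prop :=
  IsOpen B ∧ Set.InjOn 𝓖.src B ∧ Set.InjOn 𝓖.rng B

section Groupoid

variable {X G : Type*} [TopologicalSpace X] [CompactSpace X] [TopologicalSpace G]
  (𝓖 : EtaleGroupoid X G) (A : Type*) [NonUnitalCStarAlgebra A] [CXAlgebra X A]

/-- An action `α` of a groupoid `𝓖` on a `C(X)`-algebra `A`, where `X` is the unit space: a family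
of `*`-isomorphisms `α_γ : A_{s(γ)} → A_{r(γ)}` with `α_{ηγ} = α_η ∘ α_γ`, such that the map
`𝓖 *_s 𝒜 → 𝒜`, `(γ, a) ↦ α_γ(a)` is continuous. A `𝓖`-algebra is a `C(X)`-algebra with such an
action. -/
@[ext]
structure GAction where
  map : ∀ γ : G, Fibre X A (𝓖.src γ) ≃⋆ₐ[ℂ] Fibre X A (𝓖.rng γ)
  map_mul : ∀ (η γ : G) (h : 𝓖.src η = 𝓖.rng γ) (a : Fibre X A (𝓖.src γ)),
    map (𝓖.mul η γ h) (a.cast (𝓖.src_mul η γ h).symm) =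
      (map η ((map γ a).cast h.symm)).cast (𝓖.rng_mul η γ h).symm
  continuous_map : Continuous fun q : PullbackBundle 𝓖.src A =>
    (⟨𝓖.rng q.1.1, map q.1.1 (q.1.2.val.cast q.2.symm)⟩ : CXBundle X A)

variable {A}

/-- A bounded family `f(γ) ∈ A_{s(γ)}` is a continuous section of the pullback bundle. -/
def IsContinuousSection (f : lp (fun γ : G => Fibre X A (𝓖.src γ)) ∞) : Prop :=
  Continuous (toPullback 𝓖.src (fun γ => f γ))

variable {𝓖} in
theorem isContinuousSection_iff (f : lp (fun γ : G => Fibre X A (𝓖.src γ)) ∞) :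
    IsContinuousSection 𝓖 f ↔ ∀ γ, ∀ ε : ℝ, 0 < ε → ∃ a : A, ∀ᶠ η in 𝓝 γ,
      ‖f η - proj (𝓖.src η) a‖ < ε :=
  continuous_toPullback_iff 𝓖.continuous_src _

variable (A)

/-- The induced algebra `Ind A = Γ_b(𝓖, 𝓖 *_s 𝒜)` of bounded continuous sections of the pullback
of the bundle of `A` along the source map, with pointwise operations and the supremum norm, as a
`*`-subalgebra of the algebra of all bounded families. -/
noncomputable def indSubalgebra :
    NonUnitalStarSubalgebra ℂ (lp (fun γ : G => Fibre X A (𝓖.src γ)) ∞) where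
  carrier := {f | IsContinuousSection 𝓖 f}
  zero_mem' := by
    refine (isContinuousSection_iff _).mpr fun γ ε hε => ⟨0, Filter.Eventually.of_forall ?_⟩
    intro η
    simpa using hε
  add_mem' := by
    intro f g hf hg
    refine (isContinuousSection_iff _).mpr fun γ ε hε => ?_
    obtain ⟨a, ha⟩ := (isContinuousSection_iff _).mp hf γ _ (half_pos hε)
    obtain ⟨b, hb⟩ := (isContinuousSection_iff _).mp hg γ _ (half_pos hε)
    refine ⟨a + b, ?_⟩
    filter_upwards [ha, hb] with η h1 h2
    have : (f + g) η - proj (𝓖.src η) (a + b) =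
        (f η - proj (𝓖.src η) a) + (g η - proj (𝓖.src η) b) := by
      rw [map_add, lp.coeFn_add, Pi.add_apply]; abel
    rw [this]
    refine (norm_add_le _ _).trans_lt ?_
    linarith
  smul_mem' := by
    intro c f hf
    refine (isContinuousSection_iff _).mpr fun γ ε hε => ?_
    obtain ⟨a, ha⟩ := (isContinuousSection_iff _).mp hf γ (ε / (‖c‖ + 1)) (by positivity)
    refine ⟨c • a, ?_⟩
    filter_upwards [ha] with η h1
    rw [map_smul, lp.coeFn_smul, Pi.smul_apply, ← smul_sub, norm_smul]
    rw [lt_div_iff₀ (by positivity)] at h1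
    nlinarith [norm_nonneg (f η - proj (𝓖.src η) a)]
  mul_mem' := by
    intro f g hf hg
    refine (isContinuousSection_iff _).mpr fun γ ε hε => ?_
    obtain ⟨a, ha⟩ := (isContinuousSection_iff _).mp hf γ (ε / 2 / (‖g‖ + 1)) (by positivity)
    obtain ⟨b, hb⟩ := (isContinuousSection_iff _).mp hg γ (ε / 2 / (‖a‖ + 1)) (by positivity)
    refine ⟨a * b, ?_⟩
    filter_upwards [ha, hb] with η h1 h2
    have : (f * g) η - proj (𝓖.src η) (a * b) =
        (f η - proj (𝓖.src η) a) * g η + proj (𝓖.src η) a * (g η - proj (𝓖.src η) b) := by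
      rw [proj_mul, lp.infty_coeFn_mul, Pi.mul_apply, sub_mul, mul_sub]; abel
    rw [this]
    refine (norm_add_le _ _).trans_lt ?_
    rw [lt_div_iff₀ (by positivity)] at h1 h2
    have h3 := norm_mul_le (f η - proj (𝓖.src η) a) (g η)
    have h4 := norm_mul_le (proj (𝓖.src η) a) (g η - proj (𝓖.src η) b)
    have h5 : ‖g η‖ ≤ ‖g‖ := lp.norm_apply_le_norm ENNReal.top_ne_zero g η
    have h6 := norm_proj_le (𝓖.src η) a
    have h7 : ‖f η - proj (𝓖.src η) a‖ * ‖g η‖ ≤ ‖f η - proj (𝓖.src η) a‖ * (‖g‖ + 1) := by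
      gcongr; linarith
    have h8 : ‖proj (𝓖.src η) a‖ * ‖g η - proj (𝓖.src η) b‖ ≤
        (‖a‖ + 1) * ‖g η - proj (𝓖.src η) b‖ := by
      gcongr; linarith
    linarith
  star_mem' := by
    intro f hf
    refine (isContinuousSection_iff _).mpr fun γ ε hε => ?_
    obtain ⟨a, ha⟩ := (isContinuousSection_iff _).mp hf γ ε hε
    refine ⟨star a, ?_⟩
    filter_upwards [ha] with η h1
    rw [lp.coeFn_star, Pi.star_apply, proj_star, ← star_sub, norm_star]
    exact h1

instance indSubalgebra_isClosed : IsClosed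
    (indSubalgebra 𝓖 A : Set (lp (fun γ : G => Fibre X A (𝓖.src γ)) ∞)) := by
  rw [← isSeqClosed_iff_isClosed]
  intro u f hu hlim
  refine (isContinuousSection_iff _).mpr fun γ ε hε => ?_
  obtain ⟨n, hn⟩ := Metric.tendsto_atTop.mp hlim (ε / 2) (half_pos hε)
  obtain ⟨a, ha⟩ := (isContinuousSection_iff _).mp (hu n) γ (ε / 2) (half_pos hε)
  refine ⟨a, ?_⟩
  filter_upwards [ha] with η h1
  have h2 := hn n le_rfl
  rw [dist_eq_norm] at h2
  have h3 : ‖(u n - f) η‖ ≤ ‖u n - f‖ := lp.norm_apply_le_norm ENNReal.top_ne_zero _ η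
  have : f η - proj (𝓖.src η) a = (u n η - proj (𝓖.src η) a) - (u n - f) η := by
    rw [lp.coeFn_sub, Pi.sub_apply]; abel
  rw [this]
  refine (norm_sub_le _ _).trans_lt ?_
  linarith

/-- The induced algebra `Ind A = Γ_b(𝓖, 𝓖 *_s 𝒜)`. -/
def Ind : Type _ := indSubalgebra 𝓖 A

noncomputable instance : NonUnitalCStarAlgebra (Ind 𝓖 A) :=
  inferInstanceAs (NonUnitalCStarAlgebra (indSubalgebra 𝓖 A))

variable {𝓖 A}

/-- The value `f(γ) ∈ A_{s(γ)}` of a section `f ∈ Ind A` at an arrow `γ`. -/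
noncomputable def Ind.eval (f : Ind 𝓖 A) (γ : G) : Fibre X A (𝓖.src γ) :=
  (f.1 : lp (fun γ : G => Fibre X A (𝓖.src γ)) ∞) γ

@[ext]
theorem Ind.ext {f g : Ind 𝓖 A} (h : ∀ γ, f.eval γ = g.eval γ) : f = g :=
  Subtype.ext (lp.ext (funext h))

theorem Ind.norm_eval_le (f : Ind 𝓖 A) (γ : G) : ‖f.eval γ‖ ≤ ‖f‖ :=
  lp.norm_apply_le_norm ENNReal.top_ne_zero _ γ

theorem Ind.norm_le (f : Ind 𝓖 A) {C : ℝ} (hC : 0 ≤ C) (h : ∀ γ, ‖f.eval γ‖ ≤ C) : ‖f‖ ≤ C :=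
  lp.norm_le_of_forall_le hC h

theorem Ind.eval_add (f g : Ind 𝓖 A) (γ : G) : (f + g).eval γ = f.eval γ + g.eval γ := rfl

theorem Ind.eval_sub (f g : Ind 𝓖 A) (γ : G) : (f - g).eval γ = f.eval γ - g.eval γ := rfl

theorem Ind.eval_smul (c : ℂ) (f : Ind 𝓖 A) (γ : G) : (c • f).eval γ = c • f.eval γ := rfl

theorem Ind.eval_mul (f g : Ind 𝓖 A) (γ : G) : (f * g).eval γ = f.eval γ * g.eval γ := rfl

theorem Ind.eval_star (f : Ind 𝓖 A) (γ : G) : (star f).eval γ = star (f.eval γ) := rfl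

theorem Ind.locally_approx (f : Ind 𝓖 A) (γ : G) {ε : ℝ} (hε : 0 < ε) :
    ∃ a : A, ∀ᶠ η in 𝓝 γ, ‖f.eval η - proj (𝓖.src η) a‖ < ε :=
  (isContinuousSection_iff _).mp f.2 γ ε hε

/-- The element of `Ind A` given by a bounded continuous section. -/
noncomputable def Ind.mk (f : ∀ γ : G, Fibre X A (𝓖.src γ)) (C : ℝ) (hC : ∀ γ, ‖f γ‖ ≤ C)
    (hf : Continuous (toPullback 𝓖.src f)) : Ind 𝓖 A :=
  ⟨⟨f, memℓp_infty ⟨C, by rintro _ ⟨γ, rfl⟩; exact hC γ⟩⟩, hf⟩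

theorem Ind.eval_mk (f : ∀ γ : G, Fibre X A (𝓖.src γ)) (C : ℝ) (hC : ∀ γ, ‖f γ‖ ≤ C)
    (hf : Continuous (toPullback 𝓖.src f)) (γ : G) : (Ind.mk f C hC hf).eval γ = f γ := rfl

/-- The section `g f = (g ∘ r) f` for `g ∈ C(X)` and `f ∈ Ind A`. -/
noncomputable def indAct (g : C(X, ℂ)) (f : Ind 𝓖 A) : Ind 𝓖 A :=
  Ind.mk (fun γ => g (𝓖.rng γ) • f.eval γ) (‖g‖ * ‖f‖)
    (fun γ => by
      rw [norm_smul]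
      gcongr
      · exact g.norm_coe_le_norm _
      · exact f.norm_eval_le γ)
    (by
      refine (continuous_toPullback_iff 𝓖.continuous_src _).mpr fun γ ε hε => ?_
      obtain ⟨a, ha⟩ := f.locally_approx γ (ε := ε / 2 / (‖g‖ + 1)) (by positivity)
      refine ⟨g (𝓖.rng γ) • a, ?_⟩
      have hc : Filter.Tendsto (fun η => ‖g (𝓖.rng η) - g (𝓖.rng γ)‖ * ‖a‖) (𝓝 γ)
          (𝓝 (‖g (𝓖.rng γ) - g (𝓖.rng γ)‖ * ‖a‖)) := by
        have := 𝓖.continuous_rng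
        exact Continuous.tendsto (by fun_prop) γ
      rw [sub_self, norm_zero, zero_mul] at hc
      filter_upwards [ha, hc.eventually_lt_const (half_pos hε)] with η h1 h2
      have : g (𝓖.rng η) • f.eval η - proj (𝓖.src η) (g (𝓖.rng γ) • a) =
          g (𝓖.rng η) • (f.eval η - proj (𝓖.src η) a) +
            (g (𝓖.rng η) - g (𝓖.rng γ)) • proj (𝓖.src η) a := by
        rw [map_smul, smul_sub, sub_smul]; abel
      rw [this]
      refine (norm_add_le _ _).trans_lt ?_
      rw [norm_smul, norm_smul]
      rw [lt_div_iff₀ (by positivity)] at h1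
      have h3 : ‖g (𝓖.rng η) - g (𝓖.rng γ)‖ * ‖proj (𝓖.src η) a‖ ≤
          ‖g (𝓖.rng η) - g (𝓖.rng γ)‖ * ‖a‖ := by
        gcongr; exact norm_proj_le _ _
      have h4 : ‖g (𝓖.rng η)‖ * ‖f.eval η - proj (𝓖.src η) a‖ ≤
          (‖g‖ + 1) * ‖f.eval η - proj (𝓖.src η) a‖ := by
        gcongr
        exact (g.norm_coe_le_norm _).trans (by linarith)
      linarith)

theorem eval_indAct (g : C(X, ℂ)) (f : Ind 𝓖 A) (γ : G) :
    (indAct g f).eval γ = g (𝓖.rng γ) • f.eval γ := rfl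

theorem norm_indAct_le (g : C(X, ℂ)) (f : Ind 𝓖 A) : ‖indAct g f‖ ≤ ‖g‖ * ‖f‖ := by
  refine Ind.norm_le _ (by positivity) fun γ => ?_
  rw [eval_indAct, norm_smul]
  gcongr
  · exact g.norm_coe_le_norm _
  · exact f.norm_eval_le γ

/-- Multiplication by `g ∘ r` as a bounded operator on `Ind A`. -/
noncomputable def indActL (g : C(X, ℂ)) : Ind 𝓖 A →L[ℂ] Ind 𝓖 A :=
  LinearMap.mkContinuous
    { toFun := indAct g
      map_add' := fun f f' => Ind.ext fun γ => by
        simp only [eval_indAct, Ind.eval_add, smul_add]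
      map_smul' := fun c f => Ind.ext fun γ => by
        simp only [eval_indAct, Ind.eval_smul, RingHom.id_apply, smul_comm c] }
    ‖g‖ (norm_indAct_le g)

theorem eval_indActL (g : C(X, ℂ)) (f : Ind 𝓖 A) (γ : G) :
    (indActL g f).eval γ = g (𝓖.rng γ) • f.eval γ := rfl

theorem mul_indActL (g : C(X, ℂ)) (f f' : Ind 𝓖 A) : f * indActL g f' = indActL g (f * f') :=
  Ind.ext fun γ => by simp only [eval_indActL, Ind.eval_mul, mul_smul_comm]

theorem indActL_mul (g : C(X, ℂ)) (f f' : Ind 𝓖 A) : indActL g f * f' = indActL g (f * f') :=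
  Ind.ext fun γ => by simp only [eval_indActL, Ind.eval_mul, smul_mul_assoc]

/-- Multiplication by `g ∘ r` as a multiplier of `Ind A`. -/
noncomputable def indMultiplier (g : C(X, ℂ)) : 𝓜(ℂ, Ind 𝓖 A) where
  toProd := (indActL g, indActL g)
  central f f' := by
    change indActL g f * f' = f * indActL g f'
    rw [mul_indActL, indActL_mul]

/-- `Ind A` is a `C(X)`-algebra by pushforward along the range map, `g f = (g ∘ r) f`. -/
noncomputable instance : CXAlgebra X (Ind 𝓖 A) where
  toMultiplier :=
    { toFun := indMultiplier
      map_smul' := fun c g => by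
        apply DoubleCentralizer.ext
        refine Prod.ext ?_ ?_ <;>
        · refine ContinuousLinearMap.ext fun f => Ind.ext fun γ => ?_
          exact mul_smul c (g (𝓖.rng γ)) (f.eval γ)
      map_zero' := by
        apply DoubleCentralizer.ext
        refine Prod.ext ?_ ?_ <;>
        · refine ContinuousLinearMap.ext fun f => Ind.ext fun γ => ?_
          exact zero_smul ℂ (f.eval γ)
      map_add' := fun g g' => by
        apply DoubleCentralizer.ext
        refine Prod.ext ?_ ?_ <;>
        · refine ContinuousLinearMap.ext fun f => Ind.ext fun γ => ?_
          exact add_smul (g (𝓖.rng γ)) (g' (𝓖.rng γ)) (f.eval γ)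
      map_mul' := fun g g' => by
        apply DoubleCentralizer.ext
        refine Prod.ext ?_ ?_
        · refine ContinuousLinearMap.ext fun f => Ind.ext fun γ => ?_
          exact mul_smul (g (𝓖.rng γ)) (g' (𝓖.rng γ)) (f.eval γ)
        · refine ContinuousLinearMap.ext fun f => Ind.ext fun γ => ?_
          refine Eq.trans ?_ (mul_smul (g' (𝓖.rng γ)) (g (𝓖.rng γ)) (f.eval γ))
          rw [mul_comm]
          rfl
      map_star' := fun g => by
        apply DoubleCentralizer.ext
        refine Prod.ext ?_ ?_ <;>
        · refine ContinuousLinearMap.ext fun f => Ind.ext fun γ => ?_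
          change star (g (𝓖.rng γ)) • f.eval γ = star (g (𝓖.rng γ) • star (f.eval γ))
          rw [star_smul, star_star] }
  central g m := by
    have h1 : ∀ f : Ind 𝓖 A, m.fst (indActL g f) = indActL g (m.fst f) := by
      intro f
      refine eq_of_mul_left fun c => ?_
      rw [← m.central, mul_indActL, m.central, mul_indActL]
    have h2 : ∀ f : Ind 𝓖 A, m.snd (indActL g f) = indActL g (m.snd f) := by
      intro f
      refine eq_of_mul_right fun c => ?_
      rw [m.central, indActL_mul, ← m.central, indActL_mul]
    apply DoubleCentralizer.ext
    refine Prod.ext ?_ ?_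
    · exact ContinuousLinearMap.ext fun f => (h1 f).symm
    · exact ContinuousLinearMap.ext fun f => h2 f
  nondegenerate := by
    refine Dense.mono Submodule.subset_span ?_
    have : {b : Ind 𝓖 A | ∃ (g : C(X, ℂ)) (f : Ind 𝓖 A), (indMultiplier g).fst f = b} =
        Set.univ := by
      refine Set.eq_univ_of_forall fun f => ⟨1, f, Ind.ext fun γ => ?_⟩
      exact one_smul ℂ (f.eval γ)
    exact this ▸ dense_univ

theorem act_eq_indAct (g : C(X, ℂ)) (f : Ind 𝓖 A) : act g f = indAct g f := rfl

end Groupoid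

section Maps

/-- A `C(X)`-map between `C(X)`-algebras: a bounded linear map `φ` with `φ(f a) = f φ(a)` for all
`f ∈ C(X)`. Note that completely positive linear maps and `*`-homomorphisms between C*-algebras are
automatically bounded. -/
structure CXMap (X A B : Type*) [TopologicalSpace X] [CompactSpace X] [NonUnitalCStarAlgebra A]
    [CXAlgebra X A] [NonUnitalCStarAlgebra B] [CXAlgebra X B] extends A →L[ℂ] B where
  map_act' : ∀ (f : C(X, ℂ)) (a : A), toFun (act f a) = act f (toFun a)

variable {X A B C : Type*} [TopologicalSpace X] [CompactSpace X]
  [NonUnitalCStarAlgebra A] [CXAlgebra X A] [NonUnitalCStarAlgebra B] [CXAlgebra X B]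
  [NonUnitalCStarAlgebra C] [CXAlgebra X C]

instance : FunLike (CXMap X A B) A B where
  coe φ := φ.toFun
  coe_injective φ ψ h := by
    cases φ; cases ψ
    congr
    exact DFunLike.coe_injective h

theorem CXMap.ext {φ ψ : CXMap X A B} (h : ∀ a, φ a = ψ a) : φ = ψ := DFunLike.ext _ _ h

theorem CXMap.coe_clm (φ : CXMap X A B) (a : A) : φ.toContinuousLinearMap a = φ a := rfl

theorem CXMap.map_act (φ : CXMap X A B) (f : C(X, ℂ)) (a : A) : φ (act f a) = act f (φ a) :=
  φ.map_act' f a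

/-- The identity `C(X)`-map. -/
def CXMap.id (X A : Type*) [TopologicalSpace X] [CompactSpace X] [NonUnitalCStarAlgebra A]
    [CXAlgebra X A] : CXMap X A A :=
  { ContinuousLinearMap.id ℂ A with map_act' := fun _ _ => rfl }

/-- The composite `ψ ∘ φ`. -/
def CXMap.comp (ψ : CXMap X B C) (φ : CXMap X A B) : CXMap X A C :=
  { ψ.toContinuousLinearMap.comp φ.toContinuousLinearMap with
    map_act' := fun f a => by
      change ψ (φ (act f a)) = act f (ψ (φ a))
      rw [φ.map_act, ψ.map_act] }

theorem CXMap.comp_apply (ψ : CXMap X B C) (φ : CXMap X A B) (a : A) :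
    ψ.comp φ a = ψ (φ a) := rfl

theorem CXMap.map_fibreIdeal (φ : CXMap X A B) (x : X) :
    fibreIdeal A x ≤ (fibreIdeal B x).comap (φ.toContinuousLinearMap : A →ₗ[ℂ] B) := by
  intro a ha
  change φ.toContinuousLinearMap a ∈ fibreIdeal B x
  refine fibreIdeal_induction (p := fun a => φ.toContinuousLinearMap a ∈ fibreIdeal B x)
    ?_ ?_ ?_ ?_ ?_ ha
  · intro f a hf
    rw [CXMap.coe_clm, φ.map_act]
    exact act_mem_fibreIdeal hf _
  · simp
  · intro a b ha hb
    rw [map_add]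
    exact add_mem ha hb
  · intro c a ha
    rw [map_smul]
    exact Submodule.smul_mem _ _ ha
  · exact (fibreIdeal_isClosed X x).preimage φ.toContinuousLinearMap.continuous

/-- The map `φ_x : A_x → B_x`, `a + I_x ↦ φ(a) + I_x`, induced by a `C(X)`-map `φ : A → B`. -/
noncomputable def fibreMap (φ : CXMap X A B) (x : X) : Fibre X A x →ₗ[ℂ] Fibre X B x :=
  Submodule.mapQ (fibreIdeal A x) (fibreIdeal B x) (φ.toContinuousLinearMap : A →ₗ[ℂ] B)
    (φ.map_fibreIdeal x)

theorem fibreMap_proj (φ : CXMap X A B) (x : X) (a : A) :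
    fibreMap φ x (proj x a) = proj x (φ a) := rfl

theorem norm_fibreMap_le (φ : CXMap X A B) (x : X) (a : Fibre X A x) :
    ‖fibreMap φ x a‖ ≤ ‖φ.toContinuousLinearMap‖ * ‖a‖ := by
  refine le_of_forall_pos_le_add fun ε hε => ?_
  obtain ⟨b, hb, hb'⟩ := Submodule.Quotient.norm_mk_lt (S := fibreIdeal A x) a
    (ε := ε / (‖φ.toContinuousLinearMap‖ + 1)) (by positivity)
  have hb : proj x b = a := hb
  have hb' : ‖b‖ < ‖a‖ + ε / (‖φ.toContinuousLinearMap‖ + 1) := hb'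
  rw [← hb, fibreMap_proj, hb]
  refine (norm_proj_le _ _).trans ((φ.toContinuousLinearMap.le_opNorm b).trans ?_)
  have h1 : ‖φ.toContinuousLinearMap‖ * ‖b‖ ≤
      ‖φ.toContinuousLinearMap‖ * (‖a‖ + ε / (‖φ.toContinuousLinearMap‖ + 1)) := by
    gcongr
  have h2 : ‖φ.toContinuousLinearMap‖ * (ε / (‖φ.toContinuousLinearMap‖ + 1)) ≤ ε := by
    rw [mul_div_assoc', div_le_iff₀ (by positivity)]
    nlinarith [norm_nonneg φ.toContinuousLinearMap]
  linarith

/-- `φ` is a `*`-homomorphism. -/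
def IsStarHom (φ : CXMap X A B) : Prop :=
  (∀ a b, φ (a * b) = φ a * φ b) ∧ ∀ a, φ (star a) = star (φ a)

/-- `φ` is completely positive, with respect to the canonical orders of the C*-algebras. -/
def IsCompletelyPositive (φ : CXMap X A B) : Prop :=
  letI := CStarAlgebra.spectralOrder A
  letI := CStarAlgebra.spectralOrder B
  haveI := CStarAlgebra.spectralOrderedRing A
  haveI := CStarAlgebra.spectralOrderedRing B
  ∃ ψ : CompletelyPositiveMap A B, ∀ a, ψ a = φ a

/-- `e` is an identity element of the algebra. -/
def IsIdentity {R : Type*} [Mul R] (e : R) : Prop := ∀ a, e * a = a ∧ a * e = a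

/-- The algebra is unital. -/
def IsUnital (R : Type*) [Mul R] : Prop := ∃ e : R, IsIdentity e

/-- `φ : A → B` is ucp: `A` and `B` are unital and `φ` is unital and completely positive. -/
def IsUcp (φ : CXMap X A B) : Prop :=
  IsCompletelyPositive φ ∧ ∃ (e : A) (e' : B), IsIdentity e ∧ IsIdentity e' ∧ φ e = e'

end Maps

section Induction

variable {X G : Type*} [TopologicalSpace X] [CompactSpace X] [TopologicalSpace G]
  {𝓖 : EtaleGroupoid X G} {A B W : Type*} [NonUnitalCStarAlgebra A] [CXAlgebra X A]
  [NonUnitalCStarAlgebra B] [CXAlgebra X B] [NonUnitalCStarAlgebra W] [CXAlgebra X W]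

/-- `𝓖`-equivariance of a `C(X)`-map between `𝓖`-algebras:
`φ_{r(γ)}(α_γ(a)) = β_γ(φ_{s(γ)}(a))` for all `γ ∈ 𝓖` and `a ∈ A_{s(γ)}`. -/
def IsEquivariant (α : GAction 𝓖 A) (β : GAction 𝓖 B) (φ : CXMap X A B) : Prop :=
  ∀ (γ : G) (a : Fibre X A (𝓖.src γ)),
    fibreMap φ (𝓖.rng γ) (α.map γ a) = β.map γ (fibreMap φ (𝓖.src γ) a)

/-- `g = h · B.f` for sections `f, g ∈ Ind A`, an open bisection `B` and `h ∈ C(X)`: at `η` with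
`r(η) ∈ r(B)` one has `g(η) = h(r(η)) f(ξ⁻¹η)`, where `ξ ∈ B` has range `r(ξ) = r(η)`, and `g`
vanishes outside `r⁻¹(r(B))`. -/
def IsTranslate (B : Set G) (h : C(X, ℂ)) (f g : Ind 𝓖 A) : Prop :=
  (∀ (η ξ : G), ξ ∈ B → ∀ e : 𝓖.rng ξ = 𝓖.rng η,
    g.eval η = h (𝓖.rng η) •
      (f.eval (𝓖.mul (𝓖.inv ξ) η ((𝓖.src_inv ξ).trans e))).cast (𝓖.src_mul _ _ _)) ∧
  ∀ η : G, 𝓖.rng η ∉ 𝓖.rng '' B → g.eval η = 0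

/-- The action `α` of `𝓖` on `Ind A` is the one by translation of the argument: for `γ ∈ 𝓖`, an
open bisection `B` containing `γ`, and `h ∈ C(X)` which is one near `r(γ)` and vanishes outside
`r(B)`, the section `h · B.f` belongs to `Ind A` and `α_γ([f]_{s(γ)}) = [h · B.f]_{r(γ)}`. -/
def IsInducedAction (α : GAction 𝓖 (Ind 𝓖 A)) : Prop :=
  ∀ (γ : G) (B : Set G), IsOpenBisection 𝓖 B → γ ∈ B →
    ∀ h : C(X, ℂ), (∀ᶠ x in 𝓝 (𝓖.rng γ), h x = 1) → (∀ x, x ∉ 𝓖.rng '' B → h x = 0) →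
      ∀ f : Ind 𝓖 A, ∃ g : Ind 𝓖 A, IsTranslate B h f g ∧
        α.map γ (proj (𝓖.src γ) f) = proj (𝓖.rng γ) g

/-- `Ind φ : Ind A → Ind B`, `(Ind φ)(f)(γ) = φ_{s(γ)}(f(γ))`, for a `C(X)`-map `φ : A → B`. -/
noncomputable def indMap (𝓖 : EtaleGroupoid X G) (φ : CXMap X A B) :
    CXMap X (Ind 𝓖 A) (Ind 𝓖 B) :=
  { LinearMap.mkContinuous
      { toFun := fun f => Ind.mk (fun γ => fibreMap φ (𝓖.src γ) (f.eval γ))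
          (‖φ.toContinuousLinearMap‖ * ‖f‖)
          (fun γ => (norm_fibreMap_le φ _ _).trans (by gcongr; exact f.norm_eval_le γ))
          (by
            refine (continuous_toPullback_iff 𝓖.continuous_src _).mpr fun γ ε hε => ?_
            obtain ⟨a, ha⟩ := f.locally_approx γ (ε := ε / (‖φ.toContinuousLinearMap‖ + 1))
              (by positivity)
            refine ⟨φ a, ?_⟩
            filter_upwards [ha] with η h1
            rw [← fibreMap_proj, ← map_sub]
            refine (norm_fibreMap_le φ _ _).trans_lt ?_
            rw [lt_div_iff₀ (by positivity)] at h1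
            nlinarith [norm_nonneg (f.eval η - proj (𝓖.src η) a)])
        map_add' := fun f g => Ind.ext fun γ => by
          simp only [Ind.eval_mk, Ind.eval_add, map_add]
        map_smul' := fun c f => Ind.ext fun γ => by
          simp only [Ind.eval_mk, Ind.eval_smul, map_smul, RingHom.id_apply] }
      ‖φ.toContinuousLinearMap‖
      (fun f => Ind.norm_le _ (by positivity) fun γ =>
        (norm_fibreMap_le φ _ _).trans (by gcongr; exact f.norm_eval_le γ)) with
    map_act' := fun g f => Ind.ext fun γ => by
      change fibreMap φ (𝓖.src γ) (g (𝓖.rng γ) • f.eval γ) =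
        g (𝓖.rng γ) • fibreMap φ (𝓖.src γ) (f.eval γ)
      rw [map_smul] }

theorem eval_indMap (φ : CXMap X A B) (f : Ind 𝓖 A) (γ : G) :
    (indMap 𝓖 φ f).eval γ = fibreMap φ (𝓖.src γ) (f.eval γ) := rfl

@[simp] theorem Fibre.cast_cast {x y z : X} (h : x = y) (h' : y = z) (a : Fibre X A x) :
    (a.cast h).cast h' = a.cast (h.trans h') := by
  subst h; rfl

theorem Fibre.cast_injective {x y : X} (h : x = y) {a b : Fibre X A x}
    (e : a.cast h = b.cast h) : a = b := by
  subst h; exact e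

namespace GAction

theorem map_of_eq_mul (α : GAction 𝓖 W) {ζ η γ : G} (h : 𝓖.src η = 𝓖.rng γ)
    (e : ζ = 𝓖.mul η γ h) (hs : 𝓖.src ζ = 𝓖.src γ) (hr : 𝓖.rng η = 𝓖.rng ζ)
    (a : Fibre X W (𝓖.src ζ)) :
    α.map ζ a = (α.map η ((α.map γ (a.cast hs)).cast h.symm)).cast hr := by
  subst e
  have := α.map_mul η γ h (a.cast hs)
  rwa [Fibre.cast_cast, Fibre.cast_rfl] at this

theorem map_unit (α : GAction 𝓖 W) (x : X) (a : Fibre X W (𝓖.src (𝓖.unit x))) :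
    α.map (𝓖.unit x) a = a.cast ((𝓖.src_unit x).trans (𝓖.rng_unit x).symm) := by
  have hsr : 𝓖.src (𝓖.unit x) = 𝓖.rng (𝓖.unit x) := (𝓖.src_unit x).trans (𝓖.rng_unit x).symm
  have e : 𝓖.unit x = 𝓖.mul (𝓖.unit x) (𝓖.unit x) hsr := by
    rw [𝓖.mul_congr_right (congrArg 𝓖.unit (𝓖.src_unit x)).symm hsr, 𝓖.mul_unit]
  have h := α.map_of_eq_mul hsr e rfl rfl a
  rw [Fibre.cast_rfl, Fibre.cast_rfl] at h
  have h2 := (α.map (𝓖.unit x)).injective h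
  conv_rhs => rw [h2]
  rw [Fibre.cast_cast, Fibre.cast_rfl]

theorem map_inv_map (α : GAction 𝓖 W) (γ : G) (a : Fibre X W (𝓖.src γ)) :
    α.map (𝓖.inv γ) ((α.map γ a).cast (𝓖.src_inv γ).symm) = a.cast (𝓖.rng_inv γ).symm := by
  have h := α.map_of_eq_mul (𝓖.src_inv γ) (𝓖.inv_mul γ).symm (𝓖.src_unit _)
    ((𝓖.rng_inv γ).trans (𝓖.rng_unit _).symm) (a.cast (𝓖.src_unit _).symm)
  rw [map_unit, Fibre.cast_cast, Fibre.cast_cast, Fibre.cast_rfl] at h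
  refine Fibre.cast_injective ((𝓖.rng_inv γ).trans (𝓖.rng_unit _).symm) ?_
  rw [← h, Fibre.cast_cast]

theorem map_inv (α : GAction 𝓖 W) (γ : G) (b : Fibre X W (𝓖.rng γ)) :
    α.map (𝓖.inv γ) (b.cast (𝓖.src_inv γ).symm) =
      ((α.map γ).symm b).cast (𝓖.rng_inv γ).symm := by
  have h := α.map_inv_map γ ((α.map γ).symm b)
  rwa [StarAlgEquiv.apply_symm_apply] at h

theorem continuous_embedding (α : GAction 𝓖 W) (a : W) :
    Continuous (toPullback 𝓖.src fun γ => (α.map γ).symm (proj (𝓖.rng γ) a)) := by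
  refine Continuous.subtype_mk (continuous_id.prodMk ?_) _
  have h1 : Continuous fun γ : G => (⟨𝓖.rng γ, proj (𝓖.rng γ) a⟩ : CXBundle X W) :=
    (continuous_section_iff 𝓖.continuous_rng _).mpr fun γ ε hε =>
      ⟨a, Filter.Eventually.of_forall fun η => by simpa using hε⟩
  have h2 : Continuous fun γ : G =>
      (⟨(𝓖.inv γ, ⟨𝓖.rng γ, proj (𝓖.rng γ) a⟩), 𝓖.src_inv γ⟩ : PullbackBundle 𝓖.src W) :=
    Continuous.subtype_mk (𝓖.continuous_inv.prodMk h1) _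
  refine (α.continuous_map.comp h2).congr fun γ => ?_
  change (⟨𝓖.rng (𝓖.inv γ), α.map (𝓖.inv γ)
    ((proj (𝓖.rng γ) a).cast (𝓖.src_inv γ).symm)⟩ : CXBundle X W) = _
  rw [map_inv, CXBundle.mk_cast]

end GAction

/-- The embedding `ι : W → Ind W`, `ι(a)(γ) = α_γ⁻¹(a_{r(γ)})`, of a `𝓖`-algebra `(W, α)`. -/
noncomputable def indEmbedding (α : GAction 𝓖 W) : CXMap X W (Ind 𝓖 W) :=
  { LinearMap.mkContinuous
      { toFun := fun a => Ind.mk (fun γ => (α.map γ).symm (proj (𝓖.rng γ) a)) ‖a‖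
          (fun γ => by rw [StarAlgEquiv.norm_map]; exact norm_proj_le _ _)
          (α.continuous_embedding a)
        map_add' := fun a b => Ind.ext fun γ => by
          simp only [Ind.eval_mk, Ind.eval_add, map_add]
        map_smul' := fun c a => Ind.ext fun γ => by
          simp only [Ind.eval_mk, Ind.eval_smul, map_smul, RingHom.id_apply] }
      1
      (fun a => Ind.norm_le _ (by positivity) fun γ => by
        simp only [LinearMap.coe_mk, AddHom.coe_mk, Ind.eval_mk]
        rw [StarAlgEquiv.norm_map, one_mul]
        exact norm_proj_le _ _) with
    map_act' := fun g a => Ind.ext fun γ => by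
      change (α.map γ).symm (proj (𝓖.rng γ) (act g a)) =
        g (𝓖.rng γ) • (α.map γ).symm (proj (𝓖.rng γ) a)
      rw [proj_act, map_smul] }

/-- `rInd φ = Ind φ ∘ ι : W → Ind A` for a `𝓖`-algebra `(W, α)` and a `C(X)`-map `φ : W → A`. -/
noncomputable def rInd (α : GAction 𝓖 W) (φ : CXMap X W A) : CXMap X W (Ind 𝓖 A) :=
  (indMap 𝓖 φ).comp (indEmbedding α)

theorem eval_rInd (α : GAction 𝓖 W) (φ : CXMap X W A) (a : W) (γ : G) :
    (rInd α φ a).eval γ = fibreMap φ (𝓖.src γ) ((α.map γ).symm (proj (𝓖.rng γ) a)) := rfl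

end Induction

end GpdAlg

open GpdAlg

universe u v w t

namespace GpdAlg

/-! ### `C(X)`-algebras as algebras of all continuous sections of their bundles. -/

section LocalToGlobal

/-! The adjunction rests on restriction of sections to the units, `restrictMap : Ind A → A`, which
is the counit: composing with it inverts `rInd`. One composite is the identity because units act
trivially. For the other, let ψ be equivariant and write a_{r(γ)} = α_γ(b_{s(γ)}). Then
[ψ(a)]_{r(γ)} is the translate along γ of [ψ(b)]_{s(γ)}, so ψ(a)(γ) = ψ(b)(s(γ)), and ψ is recovered
from its values on units (`rInd_restrictMap_comp`). Neither positivity nor multiplicativity enters;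
for ucp maps and for *-homomorphisms it remains to see that both passages preserve the class.

Two analytic facts carry this. First, restriction lands in A because a `C(X)`-algebra contains every
continuous section of its bundle (`exists_proj_eq`). This follows from partitions of unity, once the
norm is known to be the supremum of the fibre norms (`norm_le_of_forall_norm_proj_le`).

Second, the fibre of Ind A at x is not just the sections over r⁻¹(x): that set may be infinite, and
[f]_x = 0 means that ‖f‖ tends to 0 uniformly on r⁻¹(y) as y → x (`Ind.proj_eq_zero_iff`). The
action is therefore built from germs: g translates f at γ if g(ξζ) = f(ζ) for all ξ near γ. The
sections h · B.f are such translates (`exists_isTranslate`). The class of g depends only on that of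
f, because ζ ↦ ξζ carries r⁻¹(s(ξ)) onto r⁻¹(r(ξ)). The axioms of an action then reduce to inverting
and composing germs.

Equivariance of ι : W → Ind W comes from continuity of the action on W and isometry of each α_γ.
Complete positivity of Ind φ is checked at each arrow. -/

theorem exists_cutoff {X : Type*} [TopologicalSpace X] [CompactSpace X] [T2Space X] {x : X}
    {U : Set X} (hU : U ∈ 𝓝 x) :
    ∃ h : C(X, ℂ), (∀ᶠ y in 𝓝 x, h y = 1) ∧ (∀ y ∉ U, h y = 0) ∧ ∀ y, ‖h y‖ ≤ 1 := by
  obtain ⟨K, hK, hKc, hKU⟩ := exists_mem_nhds_isClosed_subset (interior_mem_nhds.mpr hU)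
  obtain ⟨f, hf0, hf1, hf⟩ := exists_continuous_zero_one_of_isClosed
    isOpen_interior.isClosed_compl hKc
    (Set.disjoint_left.mpr fun y hy hyK => hy (hKU hyK))
  refine ⟨⟨fun y => (f y : ℂ), by fun_prop⟩, ?_, ?_, ?_⟩
  · filter_upwards [hK] with y hy
    have := hf1 hy
    simp only [Pi.one_apply] at this
    simp [this]
  · intro y hy
    have := hf0 (show y ∈ (interior U)ᶜ from fun h => hy (interior_subset h))
    simp only [Pi.zero_apply] at this
    simp [this]
  · intro y
    simp only [ContinuousMap.coe_mk]
    rw [Complex.norm_of_nonneg (hf y).1]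
    exact (hf y).2

/-- A compact Hausdorff space has finite partitions of unity subordinate to a given choice of
neighbourhoods of its points. -/
theorem exists_finite_partition {X : Type*} [TopologicalSpace X] [CompactSpace X] [T2Space X]
    (U : X → Set X) (hU : ∀ x, U x ∈ 𝓝 x) :
    ∃ (t : Finset X) (ρ : t → C(X, ℝ)), (∀ i y, 0 ≤ ρ i y) ∧ (∀ y, ∑ i, ρ i y = 1) ∧
      ∀ i y, ρ i y ≠ 0 → y ∈ U i := by
  obtain ⟨t, -, ht⟩ := isCompact_univ.elim_nhds_subcover (fun x => interior (U x))
    fun x _ => interior_mem_nhds.mpr (hU x)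
  obtain ⟨f, hf⟩ := PartitionOfUnity.exists_isSubordinate (isClosed_univ (X := X))
    (fun i : t => interior (U i)) (fun _ => isOpen_interior) (fun y hy => by
      obtain ⟨i, hi, hy'⟩ := Set.mem_iUnion₂.mp (ht hy)
      exact Set.mem_iUnion.mpr ⟨⟨i, hi⟩, hy'⟩)
  refine ⟨t, fun i => f i, fun i y => f.nonneg i y, fun y => ?_, fun i y hy => ?_⟩
  · rw [← finsum_eq_sum_of_fintype]
    exact f.sum_eq_one (Set.mem_univ y)
  · exact interior_subset (hf i (subset_tsupport _ hy))

variable {X A : Type*} [TopologicalSpace X] [CompactSpace X]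
  [NonUnitalCStarAlgebra A] [CXAlgebra X A]

/-- Without a unit, the powers with exponent 2^k are written as iterated squares. -/
theorem iterate_sq_act (f : C(X, ℂ)) (a : A) (k : ℕ) :
    (fun c : A => c * c)^[k] (act f a) = act (f ^ 2 ^ k) ((fun c : A => c * c)^[k] a) := by
  induction k with
  | zero => simp
  | succ k ih =>
    rw [Function.iterate_succ_apply', Function.iterate_succ_apply', ih, act_mul_left,
      mul_act_right, ← mul_act, ← pow_add, pow_succ, mul_two]

theorem sum_act {ι : Type*} (s : Finset ι) (f : ι → C(X, ℂ)) (a : A) :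
    act (∑ i ∈ s, f i) a = ∑ i ∈ s, act (f i) a := by
  classical
  induction s using Finset.induction_on with
  | empty => simp [act]
  | insert i s hi ih => rw [Finset.sum_insert hi, Finset.sum_insert hi, add_act, ih]

variable [T2Space X]

/-- Improves `exists_norm_act_lt` from value one at x to value one near x. A cutoff k supported
where |1 - f| < δ satisfies k a = k f a + k (1 - f) a, and the last term is at most δ‖a‖. -/
theorem exists_cutoff_norm_act_lt {x : X} {a : A} {r : ℝ} (h : ‖proj x a‖ < r) :
    ∃ f : C(X, ℂ), (∀ᶠ y in 𝓝 x, f y = 1) ∧ ‖act f a‖ < r := by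
  obtain ⟨f, hf1, hf2, hf3⟩ := exists_norm_act_lt h
  obtain ⟨δ, hδ0, hδ⟩ : ∃ δ : ℝ, 0 < δ ∧ ‖act f a‖ + δ * ‖a‖ < r :=
    ⟨(r - ‖act f a‖) / (‖a‖ + 1), div_pos (sub_pos.mpr hf3) (by positivity), by
      rw [← lt_sub_iff_add_lt', div_mul_eq_mul_div, div_lt_iff₀ (by positivity)]
      nlinarith [norm_nonneg a]⟩
  have hU : {y | ‖1 - f y‖ < δ} ∈ 𝓝 x :=
    (isOpen_lt (by fun_prop) continuous_const).mem_nhds (by simpa [hf1] using hδ0)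
  obtain ⟨k, hk1, hk0, hk⟩ := exists_cutoff hU
  refine ⟨k, hk1, ?_⟩
  have h1 : act k a = act k (act f a) + act (k * (1 - f)) a := by
    rw [← mul_act, ← add_act]; congr 1; ring
  have h2 : ‖act k (act f a)‖ ≤ ‖act f a‖ :=
    (norm_act_le _ _).trans (mul_le_of_le_one_left (norm_nonneg _)
      ((ContinuousMap.norm_le _ zero_le_one).mpr hk))
  have h3 : ‖act (k * (1 - f)) a‖ ≤ δ * ‖a‖ := by
    refine (norm_act_le _ _).trans ?_
    gcongr
    rw [ContinuousMap.norm_le _ hδ0.le]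
    intro y
    simp only [ContinuousMap.mul_apply, ContinuousMap.sub_apply, ContinuousMap.one_apply, norm_mul]
    by_cases hy : ‖1 - f y‖ < δ
    · exact (mul_le_of_le_one_left (norm_nonneg _) (hk y)).trans hy.le
    · rw [hk0 y hy, norm_zero, zero_mul]; exact hδ0.le
  rw [h1]
  exact (norm_add_le _ _).trans_lt (by linarith)

theorem norm_iterate_sq_le {R : Type*} [NonUnitalNormedRing R] (a : R) (k : ℕ) :
    ‖(fun c : R => c * c)^[k] a‖ ≤ ‖a‖ ^ 2 ^ k := by
  induction k with
  | zero => simp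
  | succ k ih =>
    rw [Function.iterate_succ_apply', pow_succ, pow_mul, sq]
    exact (norm_mul_le _ _).trans (mul_le_mul ih ih (norm_nonneg _) (by positivity))

theorem norm_iterate_sq {R : Type*} [NonUnitalNormedRing R] [StarRing R] [CStarRing R] {a : R}
    (ha : IsSelfAdjoint a) (k : ℕ) : ‖(fun c : R => c * c)^[k] a‖ = ‖a‖ ^ 2 ^ k := by
  have h : IsSelfAdjoint ((fun c : R => c * c)^[k] a) ∧
      ‖(fun c : R => c * c)^[k] a‖ = ‖a‖ ^ 2 ^ k := by
    induction k with
    | zero => simpa using ha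
    | succ k ih =>
      rw [Function.iterate_succ_apply', pow_succ, pow_mul, sq]
      refine ⟨?_, ?_⟩
      · rw [IsSelfAdjoint, star_mul, ih.1.star_eq]
      · have h := CStarRing.norm_star_mul_self (x := (fun c : R => c * c)^[k] a)
        rw [ih.1.star_eq, ih.2] at h
        exact h
  exact h.2

/-- A power trick replaces representation theory. Gluing local bounds with a finite partition of
unity loses a factor, the number of its members. That number does not change when a is replaced by
a^(2^k), whose norm is ‖a‖^(2^k), so the factor disappears as k grows. -/
theorem norm_le_of_isSelfAdjoint {a : A} (ha : IsSelfAdjoint a) {r : ℝ} (hr : 0 < r)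
    (h : ∀ x : X, ‖proj x a‖ < r) : ‖a‖ ≤ r := by
  choose f hf1 hf using fun x : X => exists_cutoff_norm_act_lt (h x)
  obtain ⟨t, ρ, hρ0, hρ1, hρU⟩ := exists_finite_partition (fun x => {y | f x y = 1}) hf1
  let σ : t → C(X, ℂ) := fun i => ⟨fun y => (ρ i y : ℂ), by fun_prop⟩
  have hσ1 : ∑ i, σ i = 1 := by
    ext y
    have := hρ1 y
    simp only [σ, ContinuousMap.sum_apply, ContinuousMap.coe_mk, ContinuousMap.one_apply]
    exact_mod_cast this
  have hσn : ∀ i, ‖σ i‖ ≤ 1 := by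
    intro i
    rw [ContinuousMap.norm_le _ zero_le_one]
    intro y
    simp only [σ, ContinuousMap.coe_mk]
    rw [Complex.norm_of_nonneg (hρ0 i y), ← hρ1 y]
    exact Finset.single_le_sum (f := fun i => ρ i y) (fun i _ => hρ0 i y) (Finset.mem_univ i)
  have key : ∀ k : ℕ, ‖a‖ ^ 2 ^ k ≤ t.card * r ^ 2 ^ k := by
    intro k
    -- On the support of σ i the function f i is one, so all powers of f i can be inserted for free.
    have h1 : ∀ i : t, act (σ i) ((fun c : A => c * c)^[k] a) =
        act (σ i) ((fun c : A => c * c)^[k] (act (f i) a)) := by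
      intro i
      rw [iterate_sq_act, ← mul_act]
      congr 1
      ext y
      simp only [ContinuousMap.mul_apply, ContinuousMap.pow_apply]
      by_cases hy : ρ i y = 0
      · simp [σ, hy]
      · rw [show f i y = 1 from hρU i y hy, one_pow, mul_one]
    rw [← norm_iterate_sq ha, ← one_act (X := X) ((fun c : A => c * c)^[k] a), ← hσ1, sum_act]
    refine (norm_sum_le_of_le (f := fun i => act (σ i) ((fun c : A => c * c)^[k] a))
      (n := fun _ => r ^ 2 ^ k) Finset.univ fun i _ => ?_).trans ?_
    · rw [h1]
      refine (norm_act_le _ _).trans ((mul_le_of_le_one_left (norm_nonneg _) (hσn i)).trans ?_)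
      exact (norm_iterate_sq_le _ _).trans (by gcongr; exact (hf i).le)
    · simp
  by_contra! hlt
  have h1 : 1 < ‖a‖ / r := (one_lt_div hr).mpr hlt
  obtain ⟨n, hn⟩ := pow_unbounded_of_one_lt (t.card : ℝ) h1
  -- Since n < 2^n, the exponent 2^n also pushes (‖a‖ / r) past the cardinality, contradicting `key
  -- n`.
  have h2 := hn.trans_le (pow_le_pow_right₀ h1.le (Nat.lt_two_pow_self (n := n)).le)
  rw [div_pow, lt_div_iff₀ (by positivity)] at h2
  exact (key n).not_gt h2

/-- The norm of an element of a `C(X)`-algebra is the supremum of the norms in the fibres. -/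
theorem norm_le_of_forall_norm_proj_le {a : A} {r : ℝ} (hr : 0 ≤ r)
    (h : ∀ x : X, ‖proj x a‖ ≤ r) : ‖a‖ ≤ r := by
  refine le_of_forall_pos_le_add fun ε hε => ?_
  have h1 : ‖star a * a‖ ≤ (r + ε) ^ 2 := by
    refine norm_le_of_isSelfAdjoint (X := X) (IsSelfAdjoint.star_mul_self a) (by positivity)
      fun x => ?_
    rw [proj_mul, proj_star, CStarRing.norm_star_mul_self, ← sq]
    exact pow_lt_pow_left₀ (lt_of_le_of_lt (h x) (by linarith)) (norm_nonneg _) two_ne_zero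
  rw [CStarRing.norm_star_mul_self, ← sq] at h1
  exact le_of_sq_le_sq h1 (by positivity)

theorem eq_of_forall_proj_eq {a b : A} (h : ∀ x : X, proj x a = proj x b) : a = b := by
  rw [← sub_eq_zero, ← norm_le_zero_iff]
  exact norm_le_of_forall_norm_proj_le (X := X) le_rfl fun x => by simp [map_sub, h x]

/-- Local approximants are averaged with a partition of unity; a convex combination of errors below
ε stays below ε. -/
theorem exists_forall_norm_sub_proj_lt (f : ∀ x, Fibre X A x)
    (hf : Continuous fun x => (⟨x, f x⟩ : CXBundle X A)) {ε : ℝ} (hε : 0 < ε) :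
    ∃ a : A, ∀ x, ‖f x - proj x a‖ < ε := by
  choose a ha using fun x => (continuous_section_iff (τ := id) continuous_id f).mp hf x ε hε
  obtain ⟨t, ρ, hρ0, hρ1, hρU⟩ := exists_finite_partition _ ha
  let σ : t → C(X, ℂ) := fun i => ⟨fun y => (ρ i y : ℂ), by fun_prop⟩
  refine ⟨∑ i, act (σ i) (a i), fun x => ?_⟩
  have h1 : f x - proj x (∑ i, act (σ i) (a i)) = ∑ i, (ρ i x : ℂ) • (f x - proj x (a i)) := by
    simp only [smul_sub, Finset.sum_sub_distrib, ← Finset.sum_smul, map_sum, proj_act]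
    congr 1
    have : ∑ i, (ρ i x : ℂ) = 1 := by exact_mod_cast hρ1 x
    rw [this, one_smul]
  rw [h1]
  refine (norm_sum_le _ _).trans_lt ?_
  have h2 : ∀ i, ‖(ρ i x : ℂ) • (f x - proj x (a i))‖ ≤ ρ i x * ε := by
    intro i
    rw [norm_smul, Complex.norm_of_nonneg (hρ0 i x)]
    by_cases hi : ρ i x = 0
    · simp [hi]
    · exact mul_le_mul_of_nonneg_left (le_of_lt (hρU i x hi)) (hρ0 i x)
  -- A nonzero weight is needed to make the final inequality strict.
  obtain ⟨i, hi⟩ : ∃ i, ρ i x ≠ 0 := by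
    by_contra! h0
    have := hρ1 x
    simp [h0] at this
  calc ∑ i, ‖(ρ i x : ℂ) • (f x - proj x (a i))‖ < ∑ i, ρ i x * ε := by
        refine Finset.sum_lt_sum (fun i _ => h2 i) ⟨i, Finset.mem_univ i, ?_⟩
        rw [norm_smul, Complex.norm_of_nonneg (hρ0 i x)]
        exact mul_lt_mul_of_pos_left (hρU i x hi) ((hρ0 i x).lt_of_ne' hi)
    _ = ε := by rw [← Finset.sum_mul, hρ1, one_mul]

/-- A `C(X)`-algebra consists of all continuous sections of its bundle. -/
theorem exists_proj_eq (f : ∀ x, Fibre X A x)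
    (hf : Continuous fun x => (⟨x, f x⟩ : CXBundle X A)) : ∃ a : A, ∀ x, proj x a = f x := by
  choose u hu using fun n : ℕ =>
    exists_forall_norm_sub_proj_lt f hf (Nat.one_div_pos_of_nat (α := ℝ) (n := n))
  -- The norm formula turns uniform closeness in the fibres into closeness in A.
  have hc : CauchySeq u := by
    refine cauchySeq_of_le_tendsto_0' (fun n : ℕ => 2 * (1 / ((n : ℝ) + 1))) (fun n m hnm => ?_)
      (by simpa using tendsto_one_div_add_atTop_nhds_zero_nat.const_mul (2 : ℝ))
    rw [dist_eq_norm]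
    refine norm_le_of_forall_norm_proj_le (X := X) (by positivity) fun x => ?_
    have h1 : proj x (u n - u m) = (f x - proj x (u m)) - (f x - proj x (u n)) := by
      rw [map_sub]; abel
    rw [h1]
    have h2 := Nat.one_div_le_one_div (α := ℝ) hnm
    have := (norm_sub_le (f x - proj x (u m)) (f x - proj x (u n)))
    linarith [hu n x, hu m x]
  obtain ⟨a, ha⟩ := cauchySeq_tendsto_of_complete hc
  refine ⟨a, fun x => ?_⟩
  have hp : Continuous (proj x : A → Fibre X A x) :=
    AddMonoidHomClass.continuous_of_bound (proj x) 1 fun a => by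
      rw [one_mul]; exact norm_proj_le x a
  refine tendsto_nhds_unique ((hp.tendsto a).comp ha) ?_
  rw [tendsto_iff_norm_sub_tendsto_zero]
  refine squeeze_zero (fun _ => norm_nonneg _) (fun n => ?_)
    tendsto_one_div_add_atTop_nhds_zero_nat
  rw [Function.comp_apply, norm_sub_rev]
  exact (hu n x).le

end LocalToGlobal

/-! ### Compatibility of the identification of equal fibres with the operations. -/

section Cast

variable {X A B : Type*} [TopologicalSpace X] [CompactSpace X]
  [NonUnitalCStarAlgebra A] [CXAlgebra X A] [NonUnitalCStarAlgebra B] [CXAlgebra X B]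

theorem Fibre.cast_add {x y : X} (h : x = y) (a b : Fibre X A x) :
    (a + b).cast h = a.cast h + b.cast h := by
  subst h; rfl

theorem Fibre.cast_sub {x y : X} (h : x = y) (a b : Fibre X A x) :
    (a - b).cast h = a.cast h - b.cast h := by
  subst h; rfl

theorem Fibre.cast_mul {x y : X} (h : x = y) (a b : Fibre X A x) :
    (a * b).cast h = a.cast h * b.cast h := by
  subst h; rfl

theorem Fibre.cast_smul {x y : X} (h : x = y) (c : ℂ) (a : Fibre X A x) :
    (c • a).cast h = c • a.cast h := by
  subst h; rfl

theorem Fibre.cast_star {x y : X} (h : x = y) (a : Fibre X A x) :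
    (star a).cast h = star (a.cast h) := by
  subst h; rfl

theorem fibreMap_cast (φ : CXMap X A B) {x y : X} (h : x = y) (a : Fibre X A x) :
    fibreMap φ y (a.cast h) = (fibreMap φ x a).cast h := by
  subst h; rfl

end Cast

/-! ### Cancellation, open bisections and neighbourhoods of products. -/

namespace EtaleGroupoid

variable {X G : Type*} [TopologicalSpace X] [TopologicalSpace G] (𝓖 : EtaleGroupoid X G)

theorem mul_congr_left {γ γ' η : G} (e : γ = γ') (h : 𝓖.src γ = 𝓖.rng η) :
    𝓖.mul γ η h = 𝓖.mul γ' η (e ▸ h) := by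
  subst e; rfl

theorem unit_mul' {x : X} {η : G} (h : x = 𝓖.rng η) :
    𝓖.mul (𝓖.unit x) η ((𝓖.src_unit x).trans h) = η := by
  subst h; exact 𝓖.unit_mul η

theorem inv_mul_cancel_left (γ ζ : G) (h : 𝓖.src γ = 𝓖.rng ζ) :
    𝓖.mul (𝓖.inv γ) (𝓖.mul γ ζ h) ((𝓖.src_inv γ).trans (𝓖.rng_mul γ ζ h).symm) = ζ := by
  rw [← 𝓖.mul_assoc (𝓖.inv γ) γ ζ (𝓖.src_inv γ) h, 𝓖.mul_congr_left (𝓖.inv_mul γ),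
    𝓖.unit_mul' h]

theorem mul_inv_cancel_left (γ η : G) (h : 𝓖.rng γ = 𝓖.rng η) :
    𝓖.mul γ (𝓖.mul (𝓖.inv γ) η ((𝓖.src_inv γ).trans h))
      ((𝓖.rng_inv γ).symm.trans (𝓖.rng_mul _ _ _).symm) = η := by
  rw [← 𝓖.mul_assoc γ (𝓖.inv γ) η (𝓖.rng_inv γ).symm, 𝓖.mul_congr_left (𝓖.mul_inv γ),
    𝓖.unit_mul' h]

theorem inv_inv (γ : G) : 𝓖.inv (𝓖.inv γ) = γ := by
  have h2 : 𝓖.src (𝓖.inv (𝓖.inv γ)) = 𝓖.src γ := (𝓖.src_inv _).trans (𝓖.rng_inv γ)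
  have h3 := 𝓖.inv_mul_cancel_left (𝓖.inv γ) γ (𝓖.src_inv γ)
  rw [𝓖.mul_congr_right (𝓖.inv_mul γ), 𝓖.mul_congr_right (congrArg 𝓖.unit h2.symm),
    𝓖.mul_unit] at h3
  exact h3

/-- Range is injective near γ and near γ⁻¹, and s = r ∘ inv, so both maps are injective on a common
neighbourhood of γ. -/
theorem exists_isOpenBisection (γ : G) : ∃ B, IsOpenBisection 𝓖 B ∧ γ ∈ B := by
  obtain ⟨e, he, he'⟩ := 𝓖.isLocalHomeomorph_rng γ
  obtain ⟨d, hd, hd'⟩ := 𝓖.isLocalHomeomorph_rng (𝓖.inv γ)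
  refine ⟨e.source ∩ 𝓖.inv ⁻¹' d.source,
    ⟨e.open_source.inter (d.open_source.preimage 𝓖.continuous_inv), ?_, ?_⟩, he, hd⟩
  · intro ξ hξ η hη h
    have h1 : 𝓖.inv ξ = 𝓖.inv η := d.injOn hξ.2 hη.2 (by
      rw [← hd', 𝓖.rng_inv, 𝓖.rng_inv, h])
    rw [← 𝓖.inv_inv ξ, h1, 𝓖.inv_inv]
  · intro ξ hξ η hη h
    exact e.injOn hξ.1 hη.1 (by rw [← he', h])

theorem eventually_mul {γ η : G} (h : 𝓖.src γ = 𝓖.rng η) {P : G → Prop}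
    (hP : ∀ᶠ χ in 𝓝 (𝓖.mul γ η h), P χ) :
    ∀ᶠ p in 𝓝 γ ×ˢ 𝓝 η, ∀ h', P (𝓖.mul p.1 p.2 h') := by
  have h1 := 𝓖.continuous_mul.continuousAt (x := ⟨(γ, η), h⟩) |>.eventually hP
  rw [nhds_subtype_eq_comap, Filter.eventually_comap, nhds_prod_eq] at h1
  exact h1.mono fun p hp h' => hp ⟨p, h'⟩ rfl

/-- If a property holds at the arrows near `ξ`, then all arrows with range near `r(ξ)` have the same
range as an arrow near `ξ`. -/
theorem eventually_exists_rng_eq {ξ : G} {P : G → Prop} (hP : ∀ᶠ ξ' in 𝓝 ξ, P ξ') :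
    ∀ᶠ y in 𝓝 (𝓖.rng ξ), ∃ ξ', P ξ' ∧ 𝓖.rng ξ' = y :=
  Filter.mem_of_superset (𝓖.isLocalHomeomorph_rng.isOpenMap.image_mem_nhds hP)
    fun _ ⟨ξ', h1, h2⟩ => ⟨ξ', h1, h2⟩

/-- Arrows near a product are products of arrows near the factors. -/
theorem eventually_eq_mul {γ η : G} (h : 𝓖.src γ = 𝓖.rng η) {P Q : G → Prop}
    (hP : ∀ᶠ γ' in 𝓝 γ, P γ') (hQ : ∀ᶠ η' in 𝓝 η, Q η') :
    ∀ᶠ χ in 𝓝 (𝓖.mul γ η h), ∃ γ' η' h', P γ' ∧ Q η' ∧ 𝓖.mul γ' η' h' = χ := by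
  -- For χ near γη, take γ' near γ with the range of χ and set η' = γ'⁻¹χ; by continuity η' is near
  -- γ⁻¹(γη) = η.
  rw [← 𝓖.inv_mul_cancel_left γ η h] at hQ
  obtain ⟨p, hp, q, hq, hpq⟩ := Filter.eventually_prod_iff.mp (𝓖.eventually_mul _ hQ)
  have h1 := 𝓖.eventually_exists_rng_eq (hP.and (𝓖.continuous_inv.continuousAt.eventually hp))
  have h2 : Filter.Tendsto 𝓖.rng (𝓝 (𝓖.mul γ η h)) (𝓝 (𝓖.rng γ)) := by
    have := 𝓖.continuous_rng.tendsto (𝓖.mul γ η h)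
    rwa [𝓖.rng_mul] at this
  filter_upwards [h2.eventually h1, hq] with χ hχ hqχ
  obtain ⟨γ', ⟨hPγ, hpγ⟩, hr⟩ := hχ
  exact ⟨γ', _, _, hPγ, hpq hpγ hqχ ((𝓖.src_inv γ').trans hr), 𝓖.mul_inv_cancel_left γ' χ hr⟩

end EtaleGroupoid

/-! ### The fibres of the induced algebra. -/

section IndFibre

variable {X G A : Type*} [TopologicalSpace X] [CompactSpace X] [TopologicalSpace G]
  {𝓖 : EtaleGroupoid X G} [NonUnitalCStarAlgebra A] [CXAlgebra X A]

theorem Ind.eval_congr (f : Ind 𝓖 A) {γ γ' : G} (h : γ = γ') :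
    f.eval γ' = (f.eval γ).cast (congrArg 𝓖.src h) := by
  subst h; rfl

/-- If g(x) = 1 and ‖g f‖ < r, then |g(y)| ‖f(γ)‖ ≤ ‖g f‖ < |g(y)| r for y = r(γ) near x. The
neighbourhood of x serves all arrows with range y at once. -/
theorem Ind.eventually_norm_eval_lt {f : Ind 𝓖 A} {x : X} {r : ℝ} (h : ‖proj x f‖ < r) :
    ∀ᶠ y in 𝓝 x, ∀ γ, 𝓖.rng γ = y → ‖f.eval γ‖ < r := by
  obtain ⟨g, hg1, -, hg3⟩ := exists_norm_act_lt h
  have hc : Filter.Tendsto (fun y => ‖g y‖ * r) (𝓝 x) (𝓝 (‖g x‖ * r)) :=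
    Continuous.tendsto (by fun_prop) x
  rw [hg1, norm_one, one_mul] at hc
  filter_upwards [hc.eventually_const_lt hg3] with y hy γ hγ
  subst hγ
  have h1 : ‖g (𝓖.rng γ)‖ * ‖f.eval γ‖ ≤ ‖act g f‖ := by
    rw [← norm_smul]
    exact Ind.norm_eval_le (act g f) γ
  exact lt_of_mul_lt_mul_left (h1.trans_lt hy) (norm_nonneg _)

theorem Ind.eval_eq_of_proj_eq {f g : Ind 𝓖 A} {γ : G}
    (h : proj (𝓖.rng γ) f = proj (𝓖.rng γ) g) : f.eval γ = g.eval γ := by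
  rw [← sub_eq_zero, ← Ind.eval_sub, ← norm_le_zero_iff]
  refine le_of_forall_pos_lt_add fun ε hε => ?_
  rw [zero_add]
  refine (Ind.eventually_norm_eval_lt (f := f - g) (x := 𝓖.rng γ) ?_).self_of_nhds γ rfl
  rwa [map_sub, h, sub_self, norm_zero]

/-- Conversely, a cutoff at x supported where f is small on the whole set r⁻¹(y) multiplies f to
norm at most ε without changing its class. -/
theorem Ind.proj_eq_zero_iff [T2Space X] {f : Ind 𝓖 A} {x : X} :
    proj x f = 0 ↔ ∀ ε > 0, ∀ᶠ y in 𝓝 x, ∀ γ, 𝓖.rng γ = y → ‖f.eval γ‖ < ε := by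
  constructor
  · intro h ε hε
    exact Ind.eventually_norm_eval_lt (by rwa [h, norm_zero])
  · intro h
    rw [← norm_le_zero_iff]
    refine le_of_forall_pos_le_add fun ε hε => ?_
    rw [zero_add]
    obtain ⟨k, hk1, hk0, hk⟩ := exists_cutoff (h ε hε)
    refine (norm_proj_le_norm_act hk1.self_of_nhds f).trans ?_
    refine Ind.norm_le _ hε.le fun γ => ?_
    rw [act_eq_indAct, eval_indAct, norm_smul]
    by_cases hγ : ∀ γ', 𝓖.rng γ' = 𝓖.rng γ → ‖f.eval γ'‖ < ε
    · exact (mul_le_of_le_one_left (norm_nonneg _) (hk _)).trans (hγ γ rfl).le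
    · rw [hk0 _ hγ, norm_zero, zero_mul]; exact hε.le

theorem Ind.proj_eq_iff [T2Space X] {f g : Ind 𝓖 A} {x : X} :
    proj x f = proj x g ↔
      ∀ ε > 0, ∀ᶠ y in 𝓝 x, ∀ γ, 𝓖.rng γ = y → ‖f.eval γ - g.eval γ‖ < ε := by
  rw [← sub_eq_zero, ← map_sub, Ind.proj_eq_zero_iff]
  rfl

end IndFibre

/-! ### Translation along germs of bisections and the action on `Ind A`. -/

section Translate

variable {X G A : Type*} [TopologicalSpace X] [CompactSpace X] [TopologicalSpace G]
  {𝓖 : EtaleGroupoid X G} [NonUnitalCStarAlgebra A] [CXAlgebra X A]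

/-- The section `g` is the translate of `f` along the germ of bisections at `γ`:
`g(ξζ) = f(ζ)` for all `ξ` near `γ` and all `ζ` composable with `ξ`. -/
def IsGermTranslate (γ : G) (f g : Ind 𝓖 A) : Prop :=
  ∀ᶠ ξ in 𝓝 γ, ∀ (ζ : G) (h : 𝓖.src ξ = 𝓖.rng ζ),
    g.eval (𝓖.mul ξ ζ h) = (f.eval ζ).cast (𝓖.src_mul ξ ζ h).symm

namespace IsGermTranslate

variable {γ : G} {f f' g g' : Ind 𝓖 A}

theorem add (h : IsGermTranslate γ f g) (h' : IsGermTranslate γ f' g') :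
    IsGermTranslate γ (f + f') (g + g') := by
  filter_upwards [h, h'] with ξ h1 h2 ζ e
  rw [Ind.eval_add, Ind.eval_add, h1, h2, Fibre.cast_add]

theorem sub (h : IsGermTranslate γ f g) (h' : IsGermTranslate γ f' g') :
    IsGermTranslate γ (f - f') (g - g') := by
  filter_upwards [h, h'] with ξ h1 h2 ζ e
  rw [Ind.eval_sub, Ind.eval_sub, h1, h2, Fibre.cast_sub]

theorem mul (h : IsGermTranslate γ f g) (h' : IsGermTranslate γ f' g') :
    IsGermTranslate γ (f * f') (g * g') := by
  filter_upwards [h, h'] with ξ h1 h2 ζ e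
  rw [Ind.eval_mul, Ind.eval_mul, h1, h2, Fibre.cast_mul]

theorem smul (c : ℂ) (h : IsGermTranslate γ f g) : IsGermTranslate γ (c • f) (c • g) := by
  filter_upwards [h] with ξ h1 ζ e
  rw [Ind.eval_smul, Ind.eval_smul, h1, Fibre.cast_smul]

theorem star (h : IsGermTranslate γ f g) : IsGermTranslate γ (star f) (star g) := by
  filter_upwards [h] with ξ h1 ζ e
  rw [Ind.eval_star, Ind.eval_star, h1, Fibre.cast_star]

theorem symm (h : IsGermTranslate γ f g) : IsGermTranslate (𝓖.inv γ) g f := by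
  -- With this form of the filter, continuity of inversion at γ⁻¹ makes ξ⁻¹ admissible for every ξ
  -- near γ⁻¹.
  have h0 : 𝓝 γ = 𝓝 (𝓖.inv (𝓖.inv γ)) := by rw [𝓖.inv_inv]
  rw [IsGermTranslate, h0] at h
  filter_upwards [𝓖.continuous_inv.continuousAt.eventually h] with ξ h1 ζ e
  have h2 := h1 (𝓖.mul ξ ζ e) ((𝓖.src_inv ξ).trans (𝓖.rng_mul ξ ζ e).symm)
  rw [g.eval_congr (𝓖.inv_mul_cancel_left ξ ζ e).symm] at h2
  refine Fibre.cast_injective (𝓖.src_mul ξ ζ e) ?_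
  rw [Fibre.cast_cast, Fibre.cast_rfl]
  have h3 := congrArg (fun a => a.cast ((congrArg 𝓖.src
    (𝓖.inv_mul_cancel_left ξ ζ e)).symm.symm)) h2
  simpa using h3.symm

/-- Every arrow near ηγ factors as ξ'ξ with ξ' near η and ξ near γ, and k(ξ'ξζ) = g(ξζ) = f(ζ). -/
theorem trans {η : G} {k : Ind 𝓖 A} (e : 𝓖.src η = 𝓖.rng γ) (h : IsGermTranslate γ f g)
    (h' : IsGermTranslate η g k) : IsGermTranslate (𝓖.mul η γ e) f k := by
  filter_upwards [𝓖.eventually_eq_mul e h' h]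
  rintro _ ⟨ξ', ξ, e', h1, h2, rfl⟩ ζ e''
  have e3 : 𝓖.src ξ = 𝓖.rng ζ := (𝓖.src_mul ξ' ξ e').symm.trans e''
  rw [k.eval_congr (𝓖.mul_assoc ξ' ξ ζ e' e3).symm, h1, h2 ζ e3]
  simp

/-- The same g serves all arrows near γ, which is the source of the continuity of the action. -/
theorem eventually (h : IsGermTranslate γ f g) : ∀ᶠ ξ in 𝓝 γ, IsGermTranslate ξ f g :=
  eventually_eventually_nhds.mpr h

/-- Every η with r(η) = r(ξ) is ξζ with ζ = ξ⁻¹η, so smallness of f on r⁻¹(s(ξ)) gives smallness of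
g on r⁻¹(r(ξ)). As ξ runs through a neighbourhood of γ, these ranges fill a neighbourhood of r(γ).
-/
theorem proj_eq_zero [T2Space X] (h : IsGermTranslate γ f g) (hf : proj (𝓖.src γ) f = 0) :
    proj (𝓖.rng γ) g = 0 := by
  rw [Ind.proj_eq_zero_iff] at hf ⊢
  intro ε hε
  filter_upwards [𝓖.eventually_exists_rng_eq
    (h.and (𝓖.continuous_src.continuousAt.eventually (hf ε hε)))]
  rintro _ ⟨ξ, ⟨h1, h2⟩, rfl⟩ η hη
  have h3 := h1 (𝓖.mul (𝓖.inv ξ) η ((𝓖.src_inv ξ).trans hη.symm))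
    ((𝓖.rng_inv ξ).symm.trans (𝓖.rng_mul _ _ _).symm)
  rw [g.eval_congr (𝓖.mul_inv_cancel_left ξ η hη.symm), h3, Fibre.norm_cast, Fibre.norm_cast]
  exact h2 _ ((𝓖.rng_mul _ _ _).trans (𝓖.rng_inv ξ))

theorem proj_eq [T2Space X] (h : IsGermTranslate γ f g) (h' : IsGermTranslate γ f' g')
    (hf : proj (𝓖.src γ) f = proj (𝓖.src γ) f') : proj (𝓖.rng γ) g = proj (𝓖.rng γ) g' := by
  rw [← sub_eq_zero, ← map_sub] at hf ⊢
  exact (h.sub h').proj_eq_zero hf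

end IsGermTranslate

/-- The translate `h · B.f` is a section of `Ind A`. -/
theorem exists_isTranslate {B : Set G} (hB : IsOpenBisection 𝓖 B) {h : C(X, ℂ)}
    (hh : ∀ x, x ∉ 𝓖.rng '' B → h x = 0) (f : Ind 𝓖 A) : ∃ g, IsTranslate B h f g := by
  classical
  let F : ∀ η : G, Fibre X A (𝓖.src η) := fun η =>
    if hη : ∃ ξ ∈ B, 𝓖.rng ξ = 𝓖.rng η then
      h (𝓖.rng η) • (f.eval (𝓖.mul (𝓖.inv hη.choose) η
        ((𝓖.src_inv _).trans hη.choose_spec.2))).cast (𝓖.src_mul _ _ _)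
    else 0
  have hF : ∀ (η ξ : G), ξ ∈ B → ∀ e : 𝓖.rng ξ = 𝓖.rng η,
      F η = h (𝓖.rng η) •
        (f.eval (𝓖.mul (𝓖.inv ξ) η ((𝓖.src_inv ξ).trans e))).cast (𝓖.src_mul _ _ _) := by
    intro η ξ hξ e
    have hη : ∃ ξ ∈ B, 𝓖.rng ξ = 𝓖.rng η := ⟨ξ, hξ, e⟩
    -- Injectivity of the range map on B makes the chosen arrow the only one.
    have h1 : hη.choose = ξ := hB.2.2 hη.choose_spec.1 hξ (hη.choose_spec.2.trans e.symm)
    simp only [F, dif_pos hη]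
    rw [f.eval_congr (𝓖.mul_congr_left (congrArg 𝓖.inv h1) _).symm]
    simp
  have hF0 : ∀ η : G, 𝓖.rng η ∉ 𝓖.rng '' B → F η = 0 := fun η hη => dif_neg hη
  have hFn : ∀ η, ‖F η‖ ≤ ‖h (𝓖.rng η)‖ * ‖f‖ := by
    intro η
    by_cases hη : 𝓖.rng η ∈ 𝓖.rng '' B
    · obtain ⟨ξ, hξ, e⟩ := hη
      rw [hF η ξ hξ e, norm_smul, Fibre.norm_cast]
      gcongr
      exact f.norm_eval_le _
    · rw [hF0 η hη, norm_zero]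
      positivity
  refine ⟨Ind.mk F (‖h‖ * ‖f‖) (fun η => (hFn η).trans ?_) ?_, hF, hF0⟩
  · gcongr
    exact h.norm_coe_le_norm _
  refine (continuous_toPullback_iff 𝓖.continuous_src _).mpr fun η ε hε => ?_
  by_cases hη : 𝓖.rng η ∈ 𝓖.rng '' B
  · obtain ⟨ξ, hξ, e⟩ := hη
    obtain ⟨a, ha⟩ := f.locally_approx (𝓖.mul (𝓖.inv ξ) η ((𝓖.src_inv ξ).trans e))
      (ε := ε / 2 / (‖h‖ + 1)) (by positivity)
    refine ⟨h (𝓖.rng η) • a, ?_⟩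
    have hc : Filter.Tendsto (fun η' => ‖h (𝓖.rng η') - h (𝓖.rng η)‖ * ‖a‖) (𝓝 η)
        (𝓝 (‖h (𝓖.rng η) - h (𝓖.rng η)‖ * ‖a‖)) := by
      have := 𝓖.continuous_rng
      exact Continuous.tendsto (by fun_prop) η
    rw [sub_self, norm_zero, zero_mul] at hc
    -- As η' → η, the arrow ξ' of B with range r(η') can be taken near ξ, so ξ'⁻¹η' is near ξ⁻¹η,
    -- where a approximates f.
    obtain ⟨p, hp, q, hq, hpq⟩ := Filter.eventually_prod_iff.mp (𝓖.eventually_mul _ ha)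
    have h1 := 𝓖.eventually_exists_rng_eq ((hB.1.eventually_mem hξ).and
      (𝓖.continuous_inv.continuousAt.eventually hp))
    rw [e] at h1
    filter_upwards [hc.eventually_lt_const (half_pos hε), hq,
      𝓖.continuous_rng.continuousAt.eventually h1] with η' h2 h3 h4
    obtain ⟨ξ', ⟨hξ', hp'⟩, e'⟩ := h4
    have h5 := hpq hp' h3 ((𝓖.src_inv ξ').trans e')
    simp only at h5
    rw [← Fibre.norm_cast (𝓖.src_mul _ _ _), Fibre.cast_sub, Fibre.cast_proj] at h5
    rw [hF η' ξ' hξ' e']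
    set b := (f.eval (𝓖.mul (𝓖.inv ξ') η' ((𝓖.src_inv ξ').trans e'))).cast (𝓖.src_mul _ _ _)
      with hb
    have h6 : h (𝓖.rng η') • b - proj (𝓖.src η') (h (𝓖.rng η) • a) =
        h (𝓖.rng η') • (b - proj (𝓖.src η') a) +
          (h (𝓖.rng η') - h (𝓖.rng η)) • proj (𝓖.src η') a := by
      rw [map_smul, smul_sub, sub_smul]; abel
    rw [h6]
    refine (norm_add_le _ _).trans_lt ?_
    rw [norm_smul, norm_smul]
    rw [lt_div_iff₀ (by positivity)] at h5
    have h7 : ‖h (𝓖.rng η') - h (𝓖.rng η)‖ * ‖proj (𝓖.src η') a‖ ≤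
        ‖h (𝓖.rng η') - h (𝓖.rng η)‖ * ‖a‖ := by
      gcongr; exact norm_proj_le _ _
    have h8 : ‖h (𝓖.rng η')‖ * ‖b - proj (𝓖.src η') a‖ ≤
        (‖h‖ + 1) * ‖b - proj (𝓖.src η') a‖ := by
      gcongr
      exact (h.norm_coe_le_norm _).trans (by linarith)
    linarith
  -- Outside r(B), boundary points included, h(r(η)) = 0 and the bound ‖F‖ ≤ |h ∘ r| ‖f‖ forces F to
  -- tend to zero at η.
  · refine ⟨0, ?_⟩
    have hc : Filter.Tendsto (fun η' => ‖h (𝓖.rng η')‖ * ‖f‖) (𝓝 η)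
        (𝓝 (‖h (𝓖.rng η)‖ * ‖f‖)) := by
      have := 𝓖.continuous_rng
      exact Continuous.tendsto (by fun_prop) η
    rw [hh _ hη, norm_zero, zero_mul] at hc
    filter_upwards [hc.eventually_lt_const hε] with η' h1
    rw [map_zero, sub_zero]
    exact (hFn η').trans_lt h1

theorem IsTranslate.isGermTranslate {B : Set G} (hB : IsOpenBisection 𝓖 B) {γ : G} (hγ : γ ∈ B)
    {h : C(X, ℂ)} (hh : ∀ᶠ x in 𝓝 (𝓖.rng γ), h x = 1) {f g : Ind 𝓖 A}
    (hg : IsTranslate B h f g) : IsGermTranslate γ f g := by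
  filter_upwards [hB.1.eventually_mem hγ, 𝓖.continuous_rng.continuousAt.eventually hh]
    with ξ hξ h1 ζ e
  rw [hg.1 (𝓖.mul ξ ζ e) ξ hξ (𝓖.rng_mul ξ ζ e).symm,
    f.eval_congr (𝓖.inv_mul_cancel_left ξ ζ e).symm,
    show h (𝓖.rng (𝓖.mul ξ ζ e)) = 1 by rwa [𝓖.rng_mul], one_smul]
  simp

variable [T2Space X]

/-- Every arrow is contained in an open bisection that supports a cutoff function. -/
theorem exists_isOpenBisection_cutoff (𝓖 : EtaleGroupoid X G) (γ : G) :
    ∃ (B : Set G) (h : C(X, ℂ)), IsOpenBisection 𝓖 B ∧ γ ∈ B ∧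
      (∀ᶠ x in 𝓝 (𝓖.rng γ), h x = 1) ∧ ∀ x, x ∉ 𝓖.rng '' B → h x = 0 := by
  obtain ⟨B, hB, hγ⟩ := 𝓖.exists_isOpenBisection γ
  obtain ⟨h, h1, h0, -⟩ := exists_cutoff
    (𝓖.isLocalHomeomorph_rng.isOpenMap.image_mem_nhds (hB.1.mem_nhds hγ))
  exact ⟨B, h, hB, hγ, h1, h0⟩

theorem exists_isGermTranslate (γ : G) (f : Ind 𝓖 A) : ∃ g, IsGermTranslate γ f g := by
  obtain ⟨B, h, hB, hγ, h1, h0⟩ := exists_isOpenBisection_cutoff 𝓖 γ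
  obtain ⟨g, hg⟩ := exists_isTranslate hB h0 f
  exact ⟨g, hg.isGermTranslate hB hγ h1⟩

/-- The map `[f]_{s(γ)} ↦ [g]_{r(γ)}`, where `g` is a translate of `f` along `γ`. -/
noncomputable def indActionFun (γ : G) (a : Fibre X (Ind 𝓖 A) (𝓖.src γ)) :
    Fibre X (Ind 𝓖 A) (𝓖.rng γ) :=
  proj (𝓖.rng γ) (exists_isGermTranslate γ (proj_surjective _ a).choose).choose

/-- Neither the chosen representative nor the chosen translate matters, by
`IsGermTranslate.proj_eq`. -/
theorem indActionFun_proj {γ : G} {f g : Ind 𝓖 A} (h : IsGermTranslate γ f g) :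
    indActionFun γ (proj (𝓖.src γ) f) = proj (𝓖.rng γ) g :=
  (exists_isGermTranslate γ (proj_surjective _ (proj (𝓖.src γ) f)).choose).choose_spec.proj_eq h
    (proj_surjective _ (proj (𝓖.src γ) f)).choose_spec

theorem indActionFun_mul (η γ : G) (e : 𝓖.src η = 𝓖.rng γ)
    (a : Fibre X (Ind 𝓖 A) (𝓖.src γ)) :
    indActionFun (𝓖.mul η γ e) (a.cast (𝓖.src_mul η γ e).symm) =
      (indActionFun η ((indActionFun γ a).cast e.symm)).cast (𝓖.rng_mul η γ e).symm := by
  obtain ⟨f, rfl⟩ := proj_surjective _ a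
  obtain ⟨g, hg⟩ := exists_isGermTranslate γ f
  obtain ⟨k, hk⟩ := exists_isGermTranslate η g
  rw [Fibre.cast_proj, indActionFun_proj (hg.trans e hk), indActionFun_proj hg, Fibre.cast_proj,
    indActionFun_proj hk, Fibre.cast_proj]

/-- Translation along `γ` as an isomorphism between the fibres of `Ind A`. -/
noncomputable def indActionEquiv (γ : G) :
    Fibre X (Ind 𝓖 A) (𝓖.src γ) ≃⋆ₐ[ℂ] Fibre X (Ind 𝓖 A) (𝓖.rng γ) where
  toFun := indActionFun γ
  invFun b := (indActionFun (𝓖.inv γ) (b.cast (𝓖.src_inv γ).symm)).cast (𝓖.rng_inv γ)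
  left_inv a := by
    obtain ⟨f, rfl⟩ := proj_surjective _ a
    obtain ⟨g, hg⟩ := exists_isGermTranslate γ f
    beta_reduce
    rw [indActionFun_proj hg, Fibre.cast_proj, indActionFun_proj hg.symm, Fibre.cast_proj]
  right_inv b := by
    obtain ⟨g, rfl⟩ := proj_surjective _ b
    obtain ⟨f, hf⟩ := exists_isGermTranslate (𝓖.inv γ) g
    have hf' := hf.symm
    rw [𝓖.inv_inv] at hf'
    beta_reduce
    rw [Fibre.cast_proj, indActionFun_proj hf, Fibre.cast_proj, indActionFun_proj hf']
  map_mul' a b := by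
    obtain ⟨f, rfl⟩ := proj_surjective _ a
    obtain ⟨f', rfl⟩ := proj_surjective _ b
    obtain ⟨g, hg⟩ := exists_isGermTranslate γ f
    obtain ⟨g', hg'⟩ := exists_isGermTranslate γ f'
    rw [← proj_mul, indActionFun_proj (hg.mul hg'), indActionFun_proj hg, indActionFun_proj hg',
      proj_mul]
  map_add' a b := by
    obtain ⟨f, rfl⟩ := proj_surjective _ a
    obtain ⟨f', rfl⟩ := proj_surjective _ b
    obtain ⟨g, hg⟩ := exists_isGermTranslate γ f
    obtain ⟨g', hg'⟩ := exists_isGermTranslate γ f'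
    rw [← map_add, indActionFun_proj (hg.add hg'), indActionFun_proj hg, indActionFun_proj hg',
      map_add]
  map_star' a := by
    obtain ⟨f, rfl⟩ := proj_surjective _ a
    obtain ⟨g, hg⟩ := exists_isGermTranslate γ f
    rw [← proj_star, indActionFun_proj hg.star, indActionFun_proj hg, proj_star]
  map_smul' c a := by
    obtain ⟨f, rfl⟩ := proj_surjective _ a
    obtain ⟨g, hg⟩ := exists_isGermTranslate γ f
    rw [← map_smul, indActionFun_proj (hg.smul c), indActionFun_proj hg, map_smul]

theorem indActionEquiv_proj {γ : G} {f g : Ind 𝓖 A} (h : IsGermTranslate γ f g) :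
    indActionEquiv γ (proj (𝓖.src γ) f) = proj (𝓖.rng γ) g :=
  indActionFun_proj h

/-- Near (γ, [f]) write ξ.c - [b] = ξ.(c - [f]) + [g - b] with one translate g for all ξ near γ. The
first term is small since ξ acts isometrically, the second by upper semicontinuity of the norm. -/
theorem continuous_indActionEquiv : Continuous fun q : PullbackBundle 𝓖.src (Ind 𝓖 A) =>
    (⟨𝓖.rng q.1.1, indActionEquiv q.1.1 (q.1.2.val.cast q.2.symm)⟩ :
      CXBundle X (Ind 𝓖 A)) := by
  refine continuous_generateFrom_iff.mpr ?_
  rintro _ ⟨b, U, ε, hU, hε, rfl⟩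
  rw [isOpen_iff_mem_nhds]
  rintro ⟨⟨γ, ⟨x, a⟩⟩, e⟩ ⟨h1, h2⟩
  change 𝓖.src γ = x at e
  subst e
  change 𝓖.rng γ ∈ U at h1
  change ‖indActionEquiv γ a - proj (𝓖.rng γ) b‖ < ε at h2
  obtain ⟨f, rfl⟩ := proj_surjective _ a
  obtain ⟨g, hg⟩ := exists_isGermTranslate γ f
  rw [indActionEquiv_proj hg, ← map_sub] at h2
  obtain ⟨δ, hδ1, hδ2⟩ := exists_between h2
  have ho : IsOpen {c : CXBundle X (Ind 𝓖 A) |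
      c.base ∈ Set.univ ∧ ‖c.val - proj c.base f‖ < ε - δ} :=
    TopologicalSpace.isOpen_generateFrom_of_mem
      ⟨f, Set.univ, ε - δ, isOpen_univ, sub_pos.mpr hδ2, rfl⟩
  have hc : Continuous fun q : PullbackBundle 𝓖.src (Ind 𝓖 A) => q.1.2 :=
    continuous_snd.comp continuous_subtype_val
  have hc' : Continuous fun q : PullbackBundle 𝓖.src (Ind 𝓖 A) => q.1.1 :=
    continuous_fst.comp continuous_subtype_val
  have h3 := (ho.preimage hc).mem_nhds
    (x := (⟨⟨γ, ⟨𝓖.src γ, proj (𝓖.src γ) f⟩⟩, rfl⟩ : PullbackBundle 𝓖.src (Ind 𝓖 A)))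
    ⟨Set.mem_univ _, by rw [sub_self, norm_zero]; exact sub_pos.mpr hδ2⟩
  have h4 := hc'.continuousAt
    (x := (⟨⟨γ, ⟨𝓖.src γ, proj (𝓖.src γ) f⟩⟩, rfl⟩ : PullbackBundle 𝓖.src (Ind 𝓖 A)))
    |>.eventually (hg.eventually.and (𝓖.continuous_rng.continuousAt.eventually
      ((hU.eventually_mem h1).and (eventually_norm_proj_lt hδ1))))
  filter_upwards [h3, h4]
  rintro ⟨⟨ξ, ⟨y, c⟩⟩, e⟩ h5 ⟨h6, h7, h8⟩
  change 𝓖.src ξ = y at e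
  subst e
  refine ⟨h7, ?_⟩
  change ‖indActionEquiv ξ c - proj (𝓖.rng ξ) b‖ < ε
  have h9 : ‖c - proj (𝓖.src ξ) f‖ < ε - δ := h5.2
  rw [← StarAlgEquiv.norm_map (indActionEquiv ξ), map_sub, indActionEquiv_proj h6] at h9
  have h10 : indActionEquiv ξ c - proj (𝓖.rng ξ) b =
      (indActionEquiv ξ c - proj (𝓖.rng ξ) g) + proj (𝓖.rng ξ) (g - b) := by
    rw [map_sub]; abel
  rw [h10]
  exact (norm_add_le _ _).trans_lt (by linarith)

variable (A 𝓖) in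
/-- The action of `𝓖` on `Ind A` by translation. -/
noncomputable def indAction : GAction 𝓖 (Ind 𝓖 A) where
  map := indActionEquiv
  map_mul := indActionFun_mul
  continuous_map := continuous_indActionEquiv

theorem indAction_map_proj {γ : G} {f g : Ind 𝓖 A} (h : IsGermTranslate γ f g) :
    (indAction A 𝓖).map γ (proj (𝓖.src γ) f) = proj (𝓖.rng γ) g :=
  indActionFun_proj h

theorem isInducedAction_indAction : IsInducedAction (indAction A 𝓖) := by
  intro γ B hB hγ h h1 h0 f
  obtain ⟨g, hg⟩ := exists_isTranslate hB h0 f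
  exact ⟨g, hg, indAction_map_proj (hg.isGermTranslate hB hγ h1)⟩

/-- Each arrow has a bisection with a cutoff, and any h · B.f is a germ translate, so the formula
fixes β on every class. -/
theorem IsInducedAction.eq_indAction {β : GAction 𝓖 (Ind 𝓖 A)} (hβ : IsInducedAction β) :
    β = indAction A 𝓖 := by
  refine GAction.ext (funext fun γ => StarAlgEquiv.ext fun a => ?_)
  obtain ⟨f, rfl⟩ := proj_surjective _ a
  obtain ⟨B, h, hB, hγ, h1, h0⟩ := exists_isOpenBisection_cutoff 𝓖 γ
  obtain ⟨g, hg, e⟩ := hβ γ B hB hγ h h1 h0 f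
  rw [e, indAction_map_proj (hg.isGermTranslate hB hγ h1)]

end Translate

/-! ### Complete positivity, tested at arrows. -/

section CompletelyPositive

/-- Positivity in a C*-algebra can be tested with a faithful family of `*`-homomorphisms. -/
theorem nonneg_of_forall_map_nonneg {R ι : Type*} {S : ι → Type*} [NonUnitalCStarAlgebra R]
    [PartialOrder R] [StarOrderedRing R] [∀ i, NonUnitalCStarAlgebra (S i)]
    [∀ i, PartialOrder (S i)] [∀ i, StarOrderedRing (S i)] (π : ∀ i, R →⋆ₙₐ[ℂ] S i)
    (hπ : ∀ r, (∀ i, π i r = 0) → r = 0) {a : R} (ha : ∀ i, 0 ≤ π i a) : 0 ≤ a := by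
  have hsa : IsSelfAdjoint a := by
    rw [IsSelfAdjoint, ← sub_eq_zero]
    refine hπ _ fun i => ?_
    rw [map_sub, map_star, (IsSelfAdjoint.of_nonneg (ha i)).star_eq, sub_self]
  rw [← CFC.negPart_eq_zero_iff a hsa]
  refine hπ _ fun i => ?_
  -- By uniqueness of the orthogonal decomposition, π i a⁻ is the negative part of π i a, which
  -- vanishes.
  have h1 := CFC.posPart_negPart_unique (a := π i a) (b := π i a⁺) (c := π i a⁻)
    (by rw [← map_sub, CFC.posPart_sub_negPart a hsa])
    (by rw [← map_mul, CFC.posPart_mul_negPart, map_zero])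
    (map_nonneg _ (CFC.posPart_nonneg a)) (map_nonneg _ (CFC.negPart_nonneg a))
  rw [← h1.2, CFC.negPart_eq_zero_iff _ (IsSelfAdjoint.of_nonneg (ha i))]
  exact ha i

theorem exists_eq_star_mul_self {R : Type*} [NonUnitalCStarAlgebra R] [PartialOrder R]
    [StarOrderedRing R] {a : R} (ha : 0 ≤ a) : ∃ b : R, a = star b * b :=
  CStarAlgebra.nonneg_iff_eq_star_mul_self.mp ha

variable {X G A B C : Type*} [TopologicalSpace X] [CompactSpace X] [TopologicalSpace G]
  {𝓖 : EtaleGroupoid X G} [NonUnitalCStarAlgebra A] [CXAlgebra X A]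
  [NonUnitalCStarAlgebra B] [CXAlgebra X B] [NonUnitalCStarAlgebra C] [CXAlgebra X C]

variable (A) in
/-- The quotient map `A → A_x` as a `*`-homomorphism. -/
noncomputable def projHom (x : X) : A →⋆ₙₐ[ℂ] Fibre X A x where
  toFun := proj x
  map_smul' := map_smul (proj x)
  map_zero' := map_zero _
  map_add' := map_add _
  map_mul' := proj_mul x
  map_star' := proj_star x

/-- The evaluation of sections at an arrow as a `*`-homomorphism. -/
noncomputable def Ind.evalHom (γ : G) : Ind 𝓖 A →⋆ₙₐ[ℂ] Fibre X A (𝓖.src γ) where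
  toFun f := f.eval γ
  map_smul' c f := Ind.eval_smul c f γ
  map_zero' := rfl
  map_add' f g := Ind.eval_add f g γ
  map_mul' f g := Ind.eval_mul f g γ
  map_star' f := Ind.eval_star f γ

theorem isCompletelyPositive_of_isStarHom {φ : CXMap X A B} (h : IsStarHom φ) :
    IsCompletelyPositive φ := by
  let := CStarAlgebra.spectralOrder A
  let := CStarAlgebra.spectralOrder B
  have := CStarAlgebra.spectralOrderedRing A
  have := CStarAlgebra.spectralOrderedRing B
  let π : A →⋆ₙₐ[ℂ] B :=
    { toFun := φ
      map_smul' := map_smul φ.toContinuousLinearMap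
      map_zero' := map_zero φ.toContinuousLinearMap
      map_add' := map_add φ.toContinuousLinearMap
      map_mul' := h.1
      map_star' := h.2 }
  exact ⟨CompletelyPositiveMapClass.toCompletelyPositiveLinearMap π, fun _ => rfl⟩

theorem IsCompletelyPositive.comp {χ : CXMap X B C} {φ : CXMap X A B}
    (hχ : IsCompletelyPositive χ) (hφ : IsCompletelyPositive φ) :
    IsCompletelyPositive (χ.comp φ) := by
  let := CStarAlgebra.spectralOrder A
  let := CStarAlgebra.spectralOrder B
  let := CStarAlgebra.spectralOrder C
  have := CStarAlgebra.spectralOrderedRing A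
  have := CStarAlgebra.spectralOrderedRing B
  have := CStarAlgebra.spectralOrderedRing C
  obtain ⟨χ', hχ'⟩ := hχ
  obtain ⟨φ', hφ'⟩ := hφ
  refine ⟨{ (χ' : B →ₗ[ℂ] C).comp (φ' : A →ₗ[ℂ] B) with
    map_cstarMatrix_nonneg' := fun k M hM =>
      χ'.map_cstarMatrix_nonneg' k _ (φ'.map_cstarMatrix_nonneg' k M hM) }, fun a => ?_⟩
  change χ' (φ' a) = χ (φ a)
  rw [hφ', hχ']

/-- Evaluations at arrows are jointly faithful on matrices over `Ind B`, so positivity is checked at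
one γ. There the matrix is lifted from the fibre to A and φ itself is applied, which avoids complete
positivity of the maps on fibres. -/
theorem isCompletelyPositive_indMap {φ : CXMap X A B} (h : IsCompletelyPositive φ) :
    IsCompletelyPositive (indMap 𝓖 φ) := by
  let := CStarAlgebra.spectralOrder A
  let := CStarAlgebra.spectralOrder B
  have := CStarAlgebra.spectralOrderedRing A
  have := CStarAlgebra.spectralOrderedRing B
  let := CStarAlgebra.spectralOrder (Ind 𝓖 A)
  let := CStarAlgebra.spectralOrder (Ind 𝓖 B)
  have := CStarAlgebra.spectralOrderedRing (Ind 𝓖 A)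
  have := CStarAlgebra.spectralOrderedRing (Ind 𝓖 B)
  let := fun x : X => CStarAlgebra.spectralOrder (Fibre X B x)
  have := fun x : X => CStarAlgebra.spectralOrderedRing (Fibre X B x)
  obtain ⟨φ', hφ⟩ := h
  refine ⟨{ (indMap 𝓖 φ).toContinuousLinearMap.toLinearMap with
    map_cstarMatrix_nonneg' := fun k M hM => ?_ }, fun _ => rfl⟩
  refine nonneg_of_forall_map_nonneg (R := CStarMatrix (Fin k) (Fin k) (Ind 𝓖 B))
    (fun γ => CStarMatrix.mapₙₐ (n := Fin k) (Ind.evalHom (𝓖 := 𝓖) (A := B) γ)) ?_ ?_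
  · intro N hN
    ext i j γ
    exact congrFun (congrFun (hN γ) i) j
  · intro γ
    obtain ⟨N, rfl⟩ := exists_eq_star_mul_self (R := CStarMatrix (Fin k) (Fin k) (Ind 𝓖 A)) hM
    -- The square root N is lifted rather than N*N, so that the lift K*K is positive.
    choose L hL using fun i j => proj_surjective (𝓖.src γ) ((N i j).eval γ)
    let K : CStarMatrix (Fin k) (Fin k) A := CStarMatrix.ofMatrix L
    have h1 := map_nonneg (CStarMatrix.mapₙₐ (n := Fin k) (projHom B (𝓖.src γ)))
      (φ'.map_cstarMatrix_nonneg' k _ (star_mul_self_nonneg K))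
    convert h1 using 1
    ext i j
    have h2 : ((star N * N) i j).eval γ = proj (𝓖.src γ) ((star K * K) i j) := by
      change Ind.evalHom γ ((star N * N) i j) = projHom A (𝓖.src γ) ((star K * K) i j)
      simp only [CStarMatrix.mul_apply, map_sum, map_mul, CStarMatrix.star_apply, map_star]
      refine Finset.sum_congr rfl fun l _ => ?_
      have h3 : ∀ i j, projHom A (𝓖.src γ) (K i j) = Ind.evalHom γ (N i j) := hL
      rw [h3, h3]
    change fibreMap φ (𝓖.src γ) (((star N * N) i j).eval γ) =
      proj (𝓖.src γ) (φ' ((star K * K) i j))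
    rw [h2, fibreMap_proj, hφ]

end CompletelyPositive

/-! ### Units, functoriality and equivariance of `Ind`. -/

section Functoriality

variable {X G A B C : Type*} [TopologicalSpace X] [CompactSpace X] [TopologicalSpace G]
  {𝓖 : EtaleGroupoid X G} [NonUnitalCStarAlgebra A] [CXAlgebra X A]
  [NonUnitalCStarAlgebra B] [CXAlgebra X B] [NonUnitalCStarAlgebra C] [CXAlgebra X C]

variable (𝓖) in
/-- The section `γ ↦ a_{s(γ)}` of `Ind A` given by `a ∈ A`. -/
noncomputable def Ind.const (a : A) : Ind 𝓖 A :=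
  Ind.mk (fun γ => proj (𝓖.src γ) a) ‖a‖ (fun γ => norm_proj_le _ a)
    ((continuous_toPullback_iff 𝓖.continuous_src _).mpr fun γ ε hε =>
      ⟨a, Filter.Eventually.of_forall fun η => by simpa using hε⟩)

theorem Ind.eval_const (a : A) (γ : G) : (Ind.const 𝓖 a).eval γ = proj (𝓖.src γ) a := rfl

theorem IsIdentity.proj {e : A} (he : IsIdentity e) (x : X) : IsIdentity (proj x e) := by
  intro a
  obtain ⟨a, rfl⟩ := proj_surjective x a
  rw [← proj_mul, ← proj_mul, (he a).1, (he a).2]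
  exact ⟨rfl, rfl⟩

theorem IsIdentity.eq {R : Type*} [Mul R] {e e' : R} (h : IsIdentity e) (h' : IsIdentity e') :
    e = e' := by
  rw [← (h e').1, (h' e).2]

theorem IsIdentity.const {e : A} (he : IsIdentity e) : IsIdentity (Ind.const 𝓖 e) := by
  intro f
  constructor <;> ext γ
  · exact (he.proj (𝓖.src γ) (f.eval γ)).1
  · exact (he.proj (𝓖.src γ) (f.eval γ)).2

theorem IsUnital.ind (h : IsUnital A) : IsUnital (Ind 𝓖 A) :=
  let ⟨_, he⟩ := h
  ⟨_, he.const⟩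

theorem indMap_id : indMap 𝓖 (CXMap.id X A) = CXMap.id X (Ind 𝓖 A) := by
  refine CXMap.ext fun f => Ind.ext fun γ => ?_
  change fibreMap (CXMap.id X A) (𝓖.src γ) (f.eval γ) = f.eval γ
  obtain ⟨a, ha⟩ := proj_surjective _ (f.eval γ)
  rw [← ha, fibreMap_proj]
  rfl

theorem fibreMap_comp (χ : CXMap X B C) (φ : CXMap X A B) (x : X) (a : Fibre X A x) :
    fibreMap (χ.comp φ) x a = fibreMap χ x (fibreMap φ x a) := by
  obtain ⟨a, rfl⟩ := proj_surjective _ a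
  rfl

theorem indMap_comp (χ : CXMap X B C) (φ : CXMap X A B) :
    indMap 𝓖 (χ.comp φ) = (indMap 𝓖 χ).comp (indMap 𝓖 φ) :=
  CXMap.ext fun _ => Ind.ext fun _ => fibreMap_comp χ φ _ _

theorem isStarHom_indMap {φ : CXMap X A B} (h : IsStarHom φ) : IsStarHom (indMap 𝓖 φ) := by
  constructor
  · intro f g
    ext γ
    rw [Ind.eval_mul, eval_indMap, eval_indMap, eval_indMap, Ind.eval_mul]
    obtain ⟨a, ha⟩ := proj_surjective _ (f.eval γ)
    obtain ⟨b, hb⟩ := proj_surjective _ (g.eval γ)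
    rw [← ha, ← hb, ← proj_mul, fibreMap_proj, fibreMap_proj, fibreMap_proj, h.1, proj_mul]
  · intro f
    ext γ
    rw [Ind.eval_star, eval_indMap, eval_indMap, Ind.eval_star]
    obtain ⟨a, ha⟩ := proj_surjective _ (f.eval γ)
    rw [← ha, ← proj_star, fibreMap_proj, fibreMap_proj, h.2, proj_star]

theorem IsStarHom.comp {χ : CXMap X B C} {φ : CXMap X A B} (hχ : IsStarHom χ)
    (hφ : IsStarHom φ) : IsStarHom (χ.comp φ) :=
  ⟨fun a b => by simp only [CXMap.comp_apply, hφ.1, hχ.1],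
    fun a => by simp only [CXMap.comp_apply, hφ.2, hχ.2]⟩

theorem isUcp_indMap {φ : CXMap X A B} (h : IsUcp φ) : IsUcp (indMap 𝓖 φ) := by
  obtain ⟨h1, e, e', he, he', h2⟩ := h
  refine ⟨isCompletelyPositive_indMap h1, _, _, he.const, he'.const, Ind.ext fun γ => ?_⟩
  rw [eval_indMap, Ind.eval_const, fibreMap_proj, h2, Ind.eval_const]

theorem IsGermTranslate.indMap {γ : G} {f g : Ind 𝓖 A} (h : IsGermTranslate γ f g)
    (φ : CXMap X A B) : IsGermTranslate γ (indMap 𝓖 φ f) (indMap 𝓖 φ g) := by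
  filter_upwards [h] with ξ h1 ζ e
  rw [eval_indMap, eval_indMap, h1 ζ e, fibreMap_cast]

/-- Translation changes the arguments of a section and `indMap` its values, so `indMap` carries germ
translates to germ translates. -/
theorem isEquivariant_indMap [T2Space X] (φ : CXMap X A B) :
    IsEquivariant (indAction A 𝓖) (indAction B 𝓖) (indMap 𝓖 φ) := by
  intro γ a
  obtain ⟨f, rfl⟩ := proj_surjective _ a
  obtain ⟨g, hg⟩ := exists_isGermTranslate γ f
  rw [indAction_map_proj hg, fibreMap_proj, fibreMap_proj, indAction_map_proj (hg.indMap φ)]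

theorem IsEquivariant.comp {α : GAction 𝓖 A} {β : GAction 𝓖 B} {δ : GAction 𝓖 C}
    {χ : CXMap X B C} {φ : CXMap X A B} (hχ : IsEquivariant β δ χ) (hφ : IsEquivariant α β φ) :
    IsEquivariant α δ (χ.comp φ) := by
  intro γ a
  rw [fibreMap_comp, fibreMap_comp, hφ, hχ]

end Functoriality

/-! ### The unit ι, the counit given by restriction, and the bijections. -/

section Adjunction

variable {X G A B W W' : Type*} [TopologicalSpace X] [CompactSpace X] [TopologicalSpace G]
  {𝓖 : EtaleGroupoid X G} [NonUnitalCStarAlgebra A] [CXAlgebra X A]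
  [NonUnitalCStarAlgebra B] [CXAlgebra X B] [NonUnitalCStarAlgebra W] [CXAlgebra X W]
  [NonUnitalCStarAlgebra W'] [CXAlgebra X W']

theorem eval_indEmbedding (α : GAction 𝓖 W) (a : W) (γ : G) :
    (indEmbedding α a).eval γ = (α.map γ).symm (proj (𝓖.rng γ) a) := rfl

theorem isStarHom_indEmbedding (α : GAction 𝓖 W) : IsStarHom (indEmbedding α) :=
  ⟨fun a b => Ind.ext fun γ => by
    rw [Ind.eval_mul, eval_indEmbedding, eval_indEmbedding, eval_indEmbedding, proj_mul, map_mul],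
  fun a => Ind.ext fun γ => by
    rw [Ind.eval_star, eval_indEmbedding, eval_indEmbedding, proj_star, map_star]⟩

theorem indEmbedding_identity (α : GAction 𝓖 W) {e : W} (he : IsIdentity e) :
    indEmbedding α e = Ind.const 𝓖 e := by
  ext γ
  rw [eval_indEmbedding, Ind.eval_const]
  refine IsIdentity.eq (fun a => ?_) (he.proj _)
  obtain ⟨b, rfl⟩ : ∃ b, (α.map γ).symm b = a := (α.map γ).symm.surjective a
  rw [← map_mul, ← map_mul, (he.proj _ b).1, (he.proj _ b).2]
  exact ⟨rfl, rfl⟩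

/-- Let b represent α_γ(a_{s(γ)}) and let g translate ι(a) at γ. At ξζ the sections g and ι(b) take
the values α_ζ⁻¹(a_{r(ζ)}) and α_ζ⁻¹α_ξ⁻¹(b_{r(ξ)}). Their distance is ‖α_ξ(a_{s(ξ)}) - b_{r(ξ)}‖,
which does not depend on ζ and is small for ξ near γ; this is the uniformity required by
`Ind.proj_eq_iff`. -/
theorem isEquivariant_indEmbedding [T2Space X] (α : GAction 𝓖 W) :
    IsEquivariant α (indAction W 𝓖) (indEmbedding α) := by
  intro γ a
  obtain ⟨a, rfl⟩ := proj_surjective _ a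
  obtain ⟨b, hb⟩ := proj_surjective _ (α.map γ (proj (𝓖.src γ) a))
  obtain ⟨g, hg⟩ := exists_isGermTranslate γ (indEmbedding α a)
  rw [← hb, fibreMap_proj, fibreMap_proj, indAction_map_proj hg, Ind.proj_eq_iff]
  intro ε hε
  have hc : Continuous fun ξ : G =>
      (⟨𝓖.rng ξ, α.map ξ (proj (𝓖.src ξ) a)⟩ : CXBundle X W) := by
    refine α.continuous_map.comp (g := fun q : PullbackBundle 𝓖.src W =>
      (⟨𝓖.rng q.1.1, α.map q.1.1 (q.1.2.val.cast q.2.symm)⟩ : CXBundle X W))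
      (f := toPullback 𝓖.src fun ξ => proj (𝓖.src ξ) a) ?_
    exact (continuous_toPullback_iff 𝓖.continuous_src _).mpr fun γ ε hε =>
      ⟨a, Filter.Eventually.of_forall fun η => by simpa using hε⟩
  have ho : IsOpen {c : CXBundle X W | c.base ∈ Set.univ ∧ ‖c.val - proj c.base b‖ < ε} :=
    TopologicalSpace.isOpen_generateFrom_of_mem ⟨b, Set.univ, ε, isOpen_univ, hε, rfl⟩
  have h1 := (ho.preimage hc).mem_nhds (x := γ)
    ⟨Set.mem_univ _, by beta_reduce; rw [← hb, sub_self, norm_zero]; exact hε⟩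
  filter_upwards [𝓖.eventually_exists_rng_eq (hg.and h1)]
  rintro _ ⟨ξ, ⟨h2, -, h3⟩, rfl⟩ η hη
  change ‖α.map ξ (proj (𝓖.src ξ) a) - proj (𝓖.rng ξ) b‖ < ε at h3
  obtain ⟨ζ, e, rfl⟩ : ∃ ζ e, 𝓖.mul ξ ζ e = η :=
    ⟨_, _, 𝓖.mul_inv_cancel_left ξ η hη.symm⟩
  have h4 := α.map_mul ξ ζ e ((α.map ζ).symm (proj (𝓖.rng ζ) a))
  rw [StarAlgEquiv.apply_symm_apply, Fibre.cast_proj] at h4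
  rw [h2 ζ e, eval_indEmbedding, eval_indEmbedding, ← StarAlgEquiv.norm_map (α.map (𝓖.mul ξ ζ e)),
    map_sub, StarAlgEquiv.apply_symm_apply, h4, ← Fibre.norm_cast (𝓖.rng_mul ξ ζ e),
    Fibre.cast_sub, Fibre.cast_cast, Fibre.cast_rfl, Fibre.cast_proj, norm_sub_rev]
  exact h3

theorem isStarHom_rInd (α : GAction 𝓖 W) {φ : CXMap X W A} (h : IsStarHom φ) :
    IsStarHom (rInd α φ) :=
  (isStarHom_indMap h).comp (isStarHom_indEmbedding α)

theorem isUcp_rInd (α : GAction 𝓖 W) {φ : CXMap X W A} (h : IsUcp φ) : IsUcp (rInd α φ) := by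
  refine ⟨(isCompletelyPositive_indMap h.1).comp
    (isCompletelyPositive_of_isStarHom (isStarHom_indEmbedding α)), ?_⟩
  obtain ⟨-, e, e', he, he', h2⟩ := h
  refine ⟨_, _, he, he'.const, Ind.ext fun γ => ?_⟩
  change (indMap 𝓖 φ (indEmbedding α e)).eval γ = _
  rw [indEmbedding_identity α he, eval_indMap, Ind.eval_const, fibreMap_proj, h2, Ind.eval_const]

theorem isEquivariant_rInd [T2Space X] (α : GAction 𝓖 W) (φ : CXMap X W A) :
    IsEquivariant α (indAction A 𝓖) (rInd α φ) :=
  (isEquivariant_indMap φ).comp (isEquivariant_indEmbedding α)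

/-- Units act as the identity. -/
theorem proj_eq_eval_rInd_unit (α : GAction 𝓖 W) (φ : CXMap X W A) (a : W) (x : X) :
    proj x (φ a) = ((rInd α φ a).eval (𝓖.unit x)).cast (𝓖.src_unit x) := by
  have h : (α.map (𝓖.unit x)).symm (proj (𝓖.rng (𝓖.unit x)) a) =
      proj (𝓖.src (𝓖.unit x)) a := by
    rw [StarAlgEquiv.symm_apply_eq, α.map_unit, Fibre.cast_proj]
  rw [eval_rInd, h, fibreMap_proj, Fibre.cast_proj]

theorem rInd_comp_left (α' : GAction 𝓖 W') (α : GAction 𝓖 W) {j : CXMap X W' W}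
    (hj : IsEquivariant α' α j) (φ : CXMap X W A) :
    rInd α' (φ.comp j) = (rInd α φ).comp j := by
  refine CXMap.ext fun a => Ind.ext fun γ => ?_
  rw [CXMap.comp_apply, eval_rInd, eval_rInd, fibreMap_comp]
  congr 1
  rw [StarAlgEquiv.eq_symm_apply, ← hj, StarAlgEquiv.apply_symm_apply, fibreMap_proj]

theorem rInd_comp_right (α : GAction 𝓖 W) (φ : CXMap X W A) (χ : CXMap X A B) :
    rInd α (χ.comp φ) = (indMap 𝓖 χ).comp (rInd α φ) := by
  refine CXMap.ext fun a => Ind.ext fun γ => ?_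
  rw [CXMap.comp_apply, eval_rInd, eval_indMap, eval_rInd, fibreMap_comp]

variable [T2Space X]

/-- The restriction to units is a continuous section over X, hence comes from an element of A by
`exists_proj_eq`. -/
theorem Ind.exists_restrict (f : Ind 𝓖 A) :
    ∃ a : A, ∀ x, proj x a = (f.eval (𝓖.unit x)).cast (𝓖.src_unit x) := by
  refine exists_proj_eq (fun x => (f.eval (𝓖.unit x)).cast (𝓖.src_unit x)) ?_
  refine (continuous_section_iff (τ := id) continuous_id _).mpr fun x ε hε => ?_
  obtain ⟨a, ha⟩ := f.locally_approx (𝓖.unit x) hε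
  refine ⟨a, ?_⟩
  filter_upwards [𝓖.continuous_unit.continuousAt.eventually ha] with y hy
  rw [← Fibre.norm_cast (𝓖.src_unit y), Fibre.cast_sub, Fibre.cast_proj] at hy
  exact hy

/-- The restriction of a section `f ∈ Ind A` to the unit space. -/
noncomputable def Ind.restrict (f : Ind 𝓖 A) : A := f.exists_restrict.choose

theorem Ind.proj_restrict (f : Ind 𝓖 A) (x : X) :
    proj x f.restrict = (f.eval (𝓖.unit x)).cast (𝓖.src_unit x) :=
  f.exists_restrict.choose_spec x

theorem Ind.norm_restrict_le (f : Ind 𝓖 A) : ‖f.restrict‖ ≤ ‖f‖ :=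
  norm_le_of_forall_norm_proj_le (X := X) (norm_nonneg f) fun x => by
    rw [Ind.proj_restrict, Fibre.norm_cast]
    exact f.norm_eval_le _

variable (𝓖 A) in
/-- The restriction of sections to the unit space as a `C(X)`-map `Ind A → A`. -/
noncomputable def restrictMap : CXMap X (Ind 𝓖 A) A :=
  { LinearMap.mkContinuous
      { toFun := Ind.restrict
        map_add' := fun f g => eq_of_forall_proj_eq (X := X) fun x => by
          rw [map_add, Ind.proj_restrict, Ind.proj_restrict, Ind.proj_restrict, Ind.eval_add,
            Fibre.cast_add]
        map_smul' := fun c f => eq_of_forall_proj_eq (X := X) fun x => by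
          rw [map_smul, Ind.proj_restrict, Ind.proj_restrict, Ind.eval_smul, Fibre.cast_smul,
            RingHom.id_apply] }
      1 (fun f => by rw [one_mul]; exact f.norm_restrict_le) with
    map_act' := fun g f => eq_of_forall_proj_eq (X := X) fun x => by
      change proj x (act g f).restrict = proj x (act g f.restrict)
      rw [proj_act, Ind.proj_restrict, Ind.proj_restrict, act_eq_indAct, eval_indAct,
        Fibre.cast_smul, 𝓖.rng_unit] }

theorem proj_restrictMap (f : Ind 𝓖 A) (x : X) :
    proj x (restrictMap A 𝓖 f) = (f.eval (𝓖.unit x)).cast (𝓖.src_unit x) :=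
  f.proj_restrict x

theorem isStarHom_restrictMap : IsStarHom (restrictMap A 𝓖) :=
  ⟨fun f g => eq_of_forall_proj_eq (X := X) fun x => by
    rw [proj_mul, proj_restrictMap, proj_restrictMap, proj_restrictMap, Ind.eval_mul,
      Fibre.cast_mul],
  fun f => eq_of_forall_proj_eq (X := X) fun x => by
    rw [proj_star, proj_restrictMap, proj_restrictMap, Ind.eval_star, Fibre.cast_star]⟩

theorem restrictMap_const (a : A) : restrictMap A 𝓖 (Ind.const 𝓖 a) = a :=
  eq_of_forall_proj_eq (X := X) fun x => by rw [proj_restrictMap, Ind.eval_const, Fibre.cast_proj]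

theorem isUcp_restrictMap_comp (hA : IsUnital A) {ψ : CXMap X W (Ind 𝓖 A)} (h : IsUcp ψ) :
    IsUcp ((restrictMap A 𝓖).comp ψ) := by
  obtain ⟨h1, e, e', he, he', h2⟩ := h
  obtain ⟨i, hi⟩ := hA
  refine ⟨(isCompletelyPositive_of_isStarHom isStarHom_restrictMap).comp h1, e, i, he, hi, ?_⟩
  -- The identity of `Ind A` is unique, hence is the constant section of the identity of A.
  rw [CXMap.comp_apply, h2, he'.eq hi.const, restrictMap_const]

theorem restrictMap_comp_rInd (α : GAction 𝓖 W) (φ : CXMap X W A) :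
    (restrictMap A 𝓖).comp (rInd α φ) = φ :=
  CXMap.ext fun a => eq_of_forall_proj_eq (X := X) fun x => by
    rw [CXMap.comp_apply, proj_restrictMap, proj_eq_eval_rInd_unit α φ a x]

theorem rInd_injective (α : GAction 𝓖 W) :
    Function.Injective (rInd α : CXMap X W A → CXMap X W (Ind 𝓖 A)) :=
  Function.LeftInverse.injective (g := fun ψ => (restrictMap A 𝓖).comp ψ)
    (restrictMap_comp_rInd α)

/-- Equivariance moves the value at γ to the unit s(γ): with b representing α_γ⁻¹(a_{r(γ)}) and g a
translate of ψ(b), the classes of ψ(a) and g at r(γ) agree, so ψ(a)(γ) = g(γ) = ψ(b)(s(γ)). -/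
theorem rInd_restrictMap_comp {α : GAction 𝓖 W} {ψ : CXMap X W (Ind 𝓖 A)}
    (hψ : IsEquivariant α (indAction A 𝓖) ψ) : rInd α ((restrictMap A 𝓖).comp ψ) = ψ := by
  refine CXMap.ext fun a => Ind.ext fun γ => ?_
  obtain ⟨b, hb⟩ := proj_surjective _ ((α.map γ).symm (proj (𝓖.rng γ) a))
  obtain ⟨g, hg⟩ := exists_isGermTranslate γ (ψ b)
  have h1 := hψ γ (proj (𝓖.src γ) b)
  rw [hb, StarAlgEquiv.apply_symm_apply, ← hb, fibreMap_proj, fibreMap_proj,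
    indAction_map_proj hg] at h1
  -- The translation identity is used with ξ = γ and ζ the unit at s(γ).
  have h2 := hg.self_of_nhds (𝓖.unit (𝓖.src γ)) (𝓖.rng_unit _).symm
  rw [g.eval_congr (𝓖.mul_unit γ).symm] at h2
  rw [eval_rInd, ← hb, fibreMap_proj, CXMap.comp_apply, proj_restrictMap,
    Ind.eval_eq_of_proj_eq h1]
  refine Fibre.cast_injective (congrArg 𝓖.src (𝓖.mul_unit γ).symm) ?_
  rw [h2, Fibre.cast_cast]

theorem bijOn_rInd_isUcp (α : GAction 𝓖 W) (hA : IsUnital A) :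
    Set.BijOn (rInd α) {φ : CXMap X W A | IsUcp φ}
      {ψ : CXMap X W (Ind 𝓖 A) | IsUcp ψ ∧ IsEquivariant α (indAction A 𝓖) ψ} :=
  ⟨fun φ hφ => ⟨isUcp_rInd α hφ, isEquivariant_rInd α φ⟩, (rInd_injective α).injOn,
    fun _ hψ => ⟨_, isUcp_restrictMap_comp hA hψ.1, rInd_restrictMap_comp hψ.2⟩⟩

theorem bijOn_rInd_isStarHom (α : GAction 𝓖 W) :
    Set.BijOn (rInd α) {φ : CXMap X W A | IsStarHom φ}
      {ψ : CXMap X W (Ind 𝓖 A) | IsStarHom ψ ∧ IsEquivariant α (indAction A 𝓖) ψ} :=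
  ⟨fun φ hφ => ⟨isStarHom_rInd α hφ, isEquivariant_rInd α φ⟩, (rInd_injective α).injOn,
    fun _ hψ => ⟨_, isStarHom_restrictMap.comp hψ.1, rInd_restrictMap_comp hψ.2⟩⟩

end Adjunction

end GpdAlg

theorem proposition3p2 {X : Type u} {G : Type v} [TopologicalSpace X] [CompactSpace X]
    [T2Space X] [TopologicalSpace G] [T2Space G] (𝓖 : EtaleGroupoid X G) :
    ∃ ind : ∀ (A : Type w) [NonUnitalCStarAlgebra A] [CXAlgebra X A], GAction 𝓖 (Ind 𝓖 A),
      -- `Ind A` is a `𝓖`-algebra: translation of the argument is a `𝓖`-action on it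
      (∀ (A : Type w) [NonUnitalCStarAlgebra A] [CXAlgebra X A],
        IsInducedAction (ind A) ∧ ∀ β : GAction 𝓖 (Ind 𝓖 A), IsInducedAction β → β = ind A) ∧
      (∀ (A : Type w) [NonUnitalCStarAlgebra A] [CXAlgebra X A],
        IsUnital A → IsUnital (Ind 𝓖 A)) ∧
      -- `Ind` is a functor
      (∀ (A : Type w) [NonUnitalCStarAlgebra A] [CXAlgebra X A],
        indMap 𝓖 (CXMap.id X A) = CXMap.id X (Ind 𝓖 A)) ∧
      (∀ (A B C : Type w) [NonUnitalCStarAlgebra A] [CXAlgebra X A] [NonUnitalCStarAlgebra B]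
        [CXAlgebra X B] [NonUnitalCStarAlgebra C] [CXAlgebra X C]
        (φ : CXMap X A B) (χ : CXMap X B C),
        indMap 𝓖 (χ.comp φ) = (indMap 𝓖 χ).comp (indMap 𝓖 φ)) ∧
      (∀ (A B : Type w) [NonUnitalCStarAlgebra A] [CXAlgebra X A] [NonUnitalCStarAlgebra B]
        [CXAlgebra X B] (φ : CXMap X A B),
        IsEquivariant (ind A) (ind B) (indMap 𝓖 φ) ∧
        (IsUcp φ → IsUcp (indMap 𝓖 φ)) ∧ (IsStarHom φ → IsStarHom (indMap 𝓖 φ))) ∧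
      -- `rInd` is a bijection from the ucp `C(X)`-maps `W → A` to the `𝓖`-equivariant ucp
      -- `C(X)`-maps `W → Ind A`, and likewise for `*`-homomorphisms
      (∀ (W : Type t) [NonUnitalCStarAlgebra W] [CXAlgebra X W] (α : GAction 𝓖 W)
        (A : Type w) [NonUnitalCStarAlgebra A] [CXAlgebra X A], IsUnital W → IsUnital A →
        Set.BijOn (rInd α) {φ : CXMap X W A | IsUcp φ}
          {ψ : CXMap X W (Ind 𝓖 A) | IsUcp ψ ∧ IsEquivariant α (ind A) ψ}) ∧
      (∀ (W : Type t) [NonUnitalCStarAlgebra W] [CXAlgebra X W] (α : GAction 𝓖 W)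
        (A : Type w) [NonUnitalCStarAlgebra A] [CXAlgebra X A],
        Set.BijOn (rInd α) {φ : CXMap X W A | IsStarHom φ}
          {ψ : CXMap X W (Ind 𝓖 A) | IsStarHom ψ ∧ IsEquivariant α (ind A) ψ}) ∧
      -- the inverse of `rInd` restricts sections from `𝓖` to the unit space
      (∀ (W : Type t) [NonUnitalCStarAlgebra W] [CXAlgebra X W] (α : GAction 𝓖 W)
        (A : Type w) [NonUnitalCStarAlgebra A] [CXAlgebra X A] (φ : CXMap X W A) (a : W) (x : X),
        proj x (φ a) = ((rInd α φ a).eval (𝓖.unit x)).cast (𝓖.src_unit x)) ∧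
      -- `rInd` is natural in the `𝓖`-algebra and in the `C(X)`-algebra
      (∀ (W' W : Type t) [NonUnitalCStarAlgebra W'] [CXAlgebra X W'] [NonUnitalCStarAlgebra W]
        [CXAlgebra X W] (α' : GAction 𝓖 W') (α : GAction 𝓖 W)
        (A : Type w) [NonUnitalCStarAlgebra A] [CXAlgebra X A] (j : CXMap X W' W)
        (φ : CXMap X W A), IsEquivariant α' α j →
        rInd α' (φ.comp j) = (rInd α φ).comp j) ∧
      (∀ (W : Type t) [NonUnitalCStarAlgebra W] [CXAlgebra X W] (α : GAction 𝓖 W)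
        (A B : Type w) [NonUnitalCStarAlgebra A] [CXAlgebra X A] [NonUnitalCStarAlgebra B]
        [CXAlgebra X B] (φ : CXMap X W A) (χ : CXMap X A B),
        rInd α (χ.comp φ) = (indMap 𝓖 χ).comp (rInd α φ)) := by
  refine ⟨fun A _ _ => indAction A 𝓖,
    fun A _ _ => ⟨isInducedAction_indAction, fun β hβ => hβ.eq_indAction⟩,
    fun A _ _ hA => hA.ind, fun A _ _ => indMap_id,
    fun A B C _ _ _ _ _ _ φ χ => indMap_comp χ φ,
    fun A B _ _ _ _ φ => ⟨isEquivariant_indMap φ, isUcp_indMap, isStarHom_indMap⟩,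
    fun W _ _ α A _ _ _ hA => bijOn_rInd_isUcp α hA,
    fun W _ _ α A _ _ => bijOn_rInd_isStarHom α,
    fun W _ _ α A _ _ φ a x => proj_eq_eval_rInd_unit α φ a x,
    fun W' W _ _ _ _ α' α A _ _ j φ hj => rInd_comp_left α' α hj φ,
    fun W _ _ α A B _ _ _ _ φ χ => rInd_comp_right α φ χ⟩
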